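/- For an irrational real number $\alpha$ with regular continued fraction expansion $\alpha=[x_0;x_1,x_2,\dots]$ put $$\rho(\alpha)=\limsup_{n\to\infty}\,[x_n;x_{n-1},\dots,x_0]\cdot[x_{n+1};x_{n+2},x_{n+3},\dots]\in[0,+\infty].$$ Let $\mathfrak D=\{\rho(\alpha):\alpha\in\mathbb R\setminus\mathbb Q\}\cap\mathbb R$ be the set of finite values of $\rho$, and let $$\mu=\inf\{z\in\mathbb R:[z,+\infty)\subset\mathfrak D\}.$$ Then the set on the right is nonempty and bounded below, so that $\mu$ is a real number, and $$\mu\le[\overline{4;1,4,1,3,1}]\cdot[\overline{3;1,4,1,4,1}]=\frac{111\,(175+\sqrt{26565})}{2030}\approx 18.4811,$$ where the bar denotes a purely periodic continued fraction, and the approximation is correct to four decimal places (the error is less than $0.00005$). -/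

import Mathlib

open Filter Topology

noncomputable section

/-- The `n`-th partial quotient `x_n` of the regular continued fraction expansion
`α = [x_0; x_1, x_2, …]`, read off from Mathlib's continued fraction algorithm. For irrational `α`
the algorithm never terminates, so the default value `0` is not used. -/
def partialQuotient (α : ℝ) (n : ℕ) : ℤ :=
  ((GenContFract.IntFractPair.stream α n).map GenContFract.IntFractPair.b).getD 0

/-- The value `[a_0; a_1, …, a_k] = a_0 + 1 / (a_1 + 1 / (⋯ + 1 / a_k))` of a finite continued
fraction, given by the list of its entries. -/
def finCF : List ℤ → ℝ
  | [] => 0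
  | a :: l => (a : ℝ) + (finCF l)⁻¹

/-- The word `(x_0, x_1, …, x_n)`. -/
def initialWord (x : ℕ → ℤ) (n : ℕ) : List ℤ :=
  (List.range (n + 1)).map x

/-- The value `[x_0; x_1, x_2, …]` of an infinite continued fraction: the limit of
`[x_0; x_1, …, x_n]` as `n → ∞` (which exists when `x_n ≥ 1` for all `n ≥ 1`). -/
def infCF (x : ℕ → ℤ) : ℝ :=
  limUnder atTop (fun n => finCF (initialWord x n))

/-- The value of the purely periodic continued fraction whose period is the list `l`. -/
def periodicCF (l : List ℤ) : ℝ :=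
  infCF (fun n => l.getD (n % l.length) 0)

/-- The product `[x_n; x_{n-1}, …, x_0] · [x_{n+1}; x_{n+2}, …]`, where the `x_i` are the partial
quotients of `α`. -/
def rhoTerm (α : ℝ) (n : ℕ) : ℝ :=
  finCF (initialWord (partialQuotient α) n).reverse *
    infCF (fun k => partialQuotient α (n + 1 + k))

/-- `ρ(α)`, the upper limit of `[x_n; x_{n-1}, …, x_0] · [x_{n+1}; x_{n+2}, …]`, an extended real
number (it is `+∞` when the partial quotients of `α` are unbounded). -/
def rho (α : ℝ) : EReal :=
  limsup (fun n : ℕ => (rhoTerm α n : EReal)) atTop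

/-- The set of all finite values of `ρ(α)`, with `α` irrational. -/
def rhoSpectrum : Set ℝ :=
  {r | ∃ α : ℝ, Irrational α ∧ rho α = (r : EReal)}

/-- The set of all real `z` such that the ray `[z, +∞)` lies in the spectrum. -/
def rayOrigins : Set ℝ :=
  {z | Set.Ici z ⊆ rhoSpectrum}

/-- The constant `μ`. -/
def mu : ℝ := sInf rayOrigins

end

/-! Let T be the product of the two periodic fractions. It suffices to realise every z ≥ T as a
value of ρ: then T is a ray origin, and ρ ≥ 0 bounds the ray origins below.

Let K be the Cantor set of all `[0; j_1, j_2, …]` with digits at most 4 such that the word 4, j_1,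
j_2, … avoids 44 and 41414. K is thick: in a binary construction of a + K (a ≥ 4), each removed gap
is, as a ratio of end points, no larger than either piece beside it (`CFNode.isThick_tree`). By a
multiplicative gap lemma (`IntervalTree.IsThick.exists_mul_eq`) the product (a + K)(b + K) is a full
interval for integers 4 ≤ a ≤ b ≤ a + 1, and these intervals cover [18.3, ∞). Hence z = [x_0; x_1,
…] · [y_0; y_1, …] with admissible x, y (`exists_admissible_mul_eq`).

The digits x and y are glued into blocks x_n, …, x_0, y_0, …, y_n, 1, 1. At the cut between x_0 and
y_0 the product tends to z (`tendsto_center`). The two cuts next to it give smaller products. At any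
other cut the adjacent digits are at most 4 and not both 4. If x_0 = y_0 = 4, the word 41414 never
occurs (it is a palindrome, so reversing x is harmless); the two factors are then at most
[4;1,4,1,3,1,…] and [3;1,4,1,4,1,…] up to an exponentially small error, and the product is
asymptotically at most T ≤ z (`Chain.mul_le`). If some first digit exceeds 4, then z ≥ 20 and the
crude bound (4 + 1)(3 + 1) is enough.

Thus forbidding 41414 produces the constant T, while leaving the Cantor set thick enough. -/

noncomputable section

/-! ### Convergence of continued fractions -/

/-- The value `[x_0; x_1, …, x_{n-1}, t]` with a real last entry. -/
def cfTail : ℕ → (ℕ → ℤ) → ℝ → ℝ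
  | 0, _, t => t
  | n + 1, x, t => x 0 + (cfTail n (fun k => x (k + 1)) t)⁻¹

lemma one_le_cfTail : ∀ (n : ℕ) (x : ℕ → ℤ) (t : ℝ), (∀ k < n, 1 ≤ x k) → 1 ≤ t →
    1 ≤ cfTail n x t
  | 0, _, _, _, ht => ht
  | n + 1, x, t, hx, ht => by
    have h := one_le_cfTail n (fun k => x (k + 1)) t (fun k hk => hx _ (by omega)) ht
    have h0 : (1 : ℝ) ≤ x 0 := by exact_mod_cast hx 0 (by omega)
    have := inv_nonneg.2 (zero_le_one.trans h)
    simp only [cfTail]; linarith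

/-- Two steps of t ↦ x + 1/t divide distances by (x_1 u + 1)(x_1 v + 1) ≥ 4 and a single step does
not increase them; the factor 2 pays for odd n. -/
lemma dist_cfTail_le : ∀ (n : ℕ) (x : ℕ → ℤ) (t t' : ℝ), (∀ k < n, 1 ≤ x k) → 1 ≤ t → 1 ≤ t' →
    |cfTail n x t - cfTail n x t'| ≤ 2 * (1 / 2) ^ n * |t - t'|
  | 0, _, t, t', _, _, _ => by
    simp only [cfTail, pow_zero]; linarith [abs_nonneg (t - t')]
  | 1, x, t, t', _, ht, ht' => by
    simp only [cfTail]
    have : (x 0 : ℝ) + t⁻¹ - (x 0 + t'⁻¹) = (t' - t) / (t * t') := by field_simp; ring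
    rw [this, abs_div, abs_sub_comm, abs_of_pos (by positivity : (0 : ℝ) < t * t'),
      div_le_iff₀ (by positivity)]
    have : 1 ≤ t * t' := by nlinarith
    nlinarith [abs_nonneg (t - t')]
  | n + 2, x, t, t', hx, ht, ht' => by
    have ih := dist_cfTail_le n (fun k => x (k + 2)) t t' (fun k hk => hx _ (by omega)) ht ht'
    have hu := one_le_cfTail n (fun k => x (k + 2)) t (fun k hk => hx _ (by omega)) ht
    have hv := one_le_cfTail n (fun k => x (k + 2)) t' (fun k hk => hx _ (by omega)) ht'
    simp only [cfTail]
    simp only [add_assoc, Nat.reduceAdd, zero_add]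
    set u := cfTail n (fun k => x (k + 2)) t
    set v := cfTail n (fun k => x (k + 2)) t'
    have h1 : (1 : ℝ) ≤ x 1 := by exact_mod_cast hx 1 (by omega)
    have hu2 : 2 ≤ x 1 * u + 1 := by nlinarith
    have hv2 : 2 ≤ x 1 * v + 1 := by nlinarith
    have e : (x 0 : ℝ) + (x 1 + u⁻¹)⁻¹ - (x 0 + (x 1 + v⁻¹)⁻¹) =
        (u - v) / ((x 1 * u + 1) * (x 1 * v + 1)) := by
      have h3 : (x 1 : ℝ) + u⁻¹ = (x 1 * u + 1) / u := by field_simp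
      have h4 : (x 1 : ℝ) + v⁻¹ = (x 1 * v + 1) / v := by field_simp
      rw [h3, h4, inv_div, inv_div]
      field_simp; ring
    have h4 : 4 ≤ (x 1 * u + 1) * (x 1 * v + 1) := by nlinarith
    rw [e, abs_div, abs_of_pos (by linarith : (0 : ℝ) < (x 1 * u + 1) * (x 1 * v + 1)),
      div_le_iff₀ (by linarith)]
    have h5 : 2 * (1 / 2 : ℝ) ^ (n + 2) * |t - t'| * 4 = 2 * (1 / 2) ^ n * |t - t'| := by
      rw [pow_add]; ring
    have h6 : 0 ≤ 2 * (1 / 2 : ℝ) ^ (n + 2) * |t - t'| := by positivity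
    nlinarith

lemma finCF_initialWord_succ (x : ℕ → ℤ) (n : ℕ) :
    finCF (initialWord x (n + 1)) = x 0 + (finCF (initialWord (fun k => x (k + 1)) n))⁻¹ := by
  have : initialWord x (n + 1) = x 0 :: initialWord (fun k => x (k + 1)) n := by
    simp only [initialWord]
    rw [List.range_succ_eq_map, List.map_cons, List.map_map]
    rfl
  rw [this, finCF]

lemma finCF_initialWord_eq : ∀ (n : ℕ) (x : ℕ → ℤ),
    finCF (initialWord x n) = cfTail n x (x n)
  | 0, x => by simp [initialWord, finCF, cfTail]
  | n + 1, x => by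
    rw [finCF_initialWord_succ, finCF_initialWord_eq n, cfTail]

lemma cfTail_succ_right : ∀ (n : ℕ) (x : ℕ → ℤ) (t : ℝ),
    cfTail (n + 1) x t = cfTail n x (x n + t⁻¹)
  | 0, x, t => by simp [cfTail]
  | n + 1, x, t => by
    rw [cfTail, cfTail_succ_right n, cfTail]

lemma eq_cfTail {x : ℕ → ℤ} {T : ℕ → ℝ} : ∀ (n : ℕ), (∀ k < n, T k = x k + (T (k + 1))⁻¹) →
    T 0 = cfTail n x (T n)
  | 0, _ => rfl
  | n + 1, h => by
    rw [cfTail_succ_right, ← h n (by omega)]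
    exact eq_cfTail n fun k hk => h k (by omega)

lemma tendsto_cfTail {x : ℕ → ℤ} {T : ℕ → ℝ} (hx : ∀ k, 1 ≤ x k) (hT : ∀ k, 1 ≤ T k)
    (h : ∀ k, T k = x k + (T (k + 1))⁻¹) :
    Tendsto (fun n => finCF (initialWord x n)) atTop (𝓝 (T 0)) := by
  rw [tendsto_iff_dist_tendsto_zero]
  have h2 : Tendsto (fun n : ℕ => 2 * (1 / 2 : ℝ) ^ n) atTop (𝓝 0) := by
    simpa using (tendsto_pow_atTop_nhds_zero_of_lt_one (by norm_num : (0 : ℝ) ≤ 1 / 2)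
      (by norm_num)).const_mul 2
  refine squeeze_zero (fun _ => dist_nonneg) (fun n => ?_) h2
  rw [Real.dist_eq, finCF_initialWord_eq, eq_cfTail n fun k _ => h k]
  refine (dist_cfTail_le n x _ _ (fun k _ => hx k) (by exact_mod_cast hx n) (hT n)).trans ?_
  have : |(x n : ℝ) - T n| ≤ 1 := by
    rw [h n]
    have := inv_le_one_of_one_le₀ (hT (n + 1))
    have := inv_nonneg.2 (zero_le_one.trans (hT (n + 1)))
    rw [abs_le]; constructor <;> linarith
  nlinarith [pow_pos (by norm_num : (0 : ℝ) < 1 / 2) n]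

lemma infCF_eq_of_chain {x : ℕ → ℤ} {T : ℕ → ℝ} (hx : ∀ k, 1 ≤ x k) (hT : ∀ k, 1 ≤ T k)
    (h : ∀ k, T k = x k + (T (k + 1))⁻¹) : infCF x = T 0 :=
  (tendsto_cfTail hx hT h).limUnder_eq

lemma tendsto_infCF {x : ℕ → ℤ} (hx : ∀ k, 1 ≤ x k) :
    Tendsto (fun n => finCF (initialWord x n)) atTop (𝓝 (infCF x)) := by
  have hc : CauchySeq (fun n => finCF (initialWord x n)) := by
    refine cauchySeq_of_le_geometric (1 / 2) 2 (by norm_num) fun n => ?_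
    rw [Real.dist_eq, finCF_initialWord_eq, finCF_initialWord_eq, cfTail_succ_right]
    have h1 : (1 : ℝ) ≤ x n := by exact_mod_cast hx n
    have h2 : (1 : ℝ) ≤ x (n + 1) := by exact_mod_cast hx (n + 1)
    have h3 := inv_le_one_of_one_le₀ h2
    have h4 := inv_nonneg.2 (zero_le_one.trans h2)
    refine (dist_cfTail_le n x _ _ (fun k _ => hx k) h1 (by linarith)).trans ?_
    have : |(x n : ℝ) - (x n + (x (n + 1) : ℝ)⁻¹)| ≤ 1 := by
      rw [abs_le]; constructor <;> linarith
    nlinarith [pow_pos (by norm_num : (0 : ℝ) < 1 / 2) n]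
  obtain ⟨l, hl⟩ := cauchySeq_tendsto_of_complete hc
  rwa [infCF, hl.limUnder_eq]

lemma one_le_infCF {x : ℕ → ℤ} (hx : ∀ k, 1 ≤ x k) : 1 ≤ infCF x := by
  refine ge_of_tendsto' (tendsto_infCF hx) fun n => ?_
  rw [finCF_initialWord_eq]
  exact one_le_cfTail n x _ (fun k _ => hx k) (by exact_mod_cast hx n)

lemma infCF_eq_add_inv {x : ℕ → ℤ} (hx : ∀ k, 1 ≤ x k) :
    infCF x = x 0 + (infCF fun k => x (k + 1))⁻¹ := by
  have h1 := (tendsto_infCF hx).comp (tendsto_add_atTop_nat 1)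
  have h2 := tendsto_infCF (x := fun k => x (k + 1)) fun k => hx _
  have h3 := one_le_infCF (x := fun k => x (k + 1)) fun k => hx _
  refine tendsto_nhds_unique h1 ?_
  refine ((h2.inv₀ (by linarith)).const_add (x 0 : ℝ)).congr fun n => ?_
  rw [Function.comp, finCF_initialWord_succ]

/-! ### Complete quotients, reversed fractions, and irrationals with prescribed digits -/

/-- The complete quotients `[x_n; x_{n+1}, …]`. -/
def rightCF (x : ℕ → ℤ) (n : ℕ) : ℝ := infCF fun k => x (n + k)

/-- The reversed fractions `[x_n; x_{n-1}, …, x_0]`. -/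
def leftCF (x : ℕ → ℤ) (n : ℕ) : ℝ := finCF (initialWord x n).reverse

lemma rightCF_eq {x : ℕ → ℤ} {n : ℕ} (hx : ∀ k, n ≤ k → 1 ≤ x k) :
    rightCF x n = x n + (rightCF x (n + 1))⁻¹ := by
  rw [rightCF, infCF_eq_add_inv fun k => hx _ (by omega), rightCF]
  simp only [add_zero, add_assoc, add_comm 1]

lemma one_le_rightCF {x : ℕ → ℤ} {n : ℕ} (hx : ∀ k, n ≤ k → 1 ≤ x k) : 1 ≤ rightCF x n :=
  one_le_infCF fun _ => hx _ (by omega)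

lemma leftCF_zero (x : ℕ → ℤ) : leftCF x 0 = x 0 := by
  simp [leftCF, initialWord, finCF]

lemma leftCF_succ (x : ℕ → ℤ) (n : ℕ) : leftCF x (n + 1) = x (n + 1) + (leftCF x n)⁻¹ := by
  have : (initialWord x (n + 1)).reverse = x (n + 1) :: (initialWord x n).reverse := by
    simp only [initialWord]
    rw [List.range_succ, List.map_append, List.reverse_append]
    rfl
  rw [leftCF, this, finCF, leftCF]

lemma one_le_leftCF {x : ℕ → ℤ} (hx : ∀ k, 1 ≤ x k) : ∀ n, 1 ≤ leftCF x n
  | 0 => by rw [leftCF_zero]; exact_mod_cast hx 0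
  | n + 1 => by
    have h := one_le_leftCF hx n
    have h0 : (1 : ℝ) ≤ x (n + 1) := by exact_mod_cast hx (n + 1)
    have := inv_nonneg.2 (zero_le_one.trans h)
    rw [leftCF_succ]; linarith

lemma rhoTerm_eq (α : ℝ) (n : ℕ) :
    rhoTerm α n = leftCF (partialQuotient α) n * rightCF (partialQuotient α) (n + 1) := rfl

-- As 0 < 1/T_{k+1} < 1, the relation T_k = x_k + 1/T_{k+1} splits T_k into its integer and
-- fractional parts, so the chain is a run of the algorithm.
open GenContFract in
lemma stream_eq_of_chain {x : ℕ → ℤ} {T : ℕ → ℝ} (hT : ∀ k, 1 < T k)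
    (h : ∀ k, T k = x k + (T (k + 1))⁻¹) (n : ℕ) :
    IntFractPair.stream (T 0) n = some ⟨x n, (T (n + 1))⁻¹⟩ := by
  have key : ∀ k, IntFractPair.of (T k) = ⟨x k, (T (k + 1))⁻¹⟩ := by
    intro k
    have h1 : (T (k + 1))⁻¹ < 1 := inv_lt_one_of_one_lt₀ (hT _)
    have h2 : 0 ≤ (T (k + 1))⁻¹ := inv_nonneg.2 (zero_le_one.trans (hT _).le)
    have hf : ⌊T k⌋ = x k := by
      rw [Int.floor_eq_iff]; constructor <;> linarith [h k]
    simp only [IntFractPair.of, hf, Int.fract]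
    rw [h k]; simp
  induction n with
  | zero => simp [IntFractPair.stream, key]
  | succ n ih =>
    rw [IntFractPair.stream, ih]
    have : (T (n + 1))⁻¹ ≠ 0 := inv_ne_zero (by linarith [hT (n + 1)])
    simp [this, key]

lemma partialQuotient_eq_of_chain {x : ℕ → ℤ} {T : ℕ → ℝ} (hT : ∀ k, 1 < T k)
    (h : ∀ k, T k = x k + (T (k + 1))⁻¹) : partialQuotient (T 0) = x := by
  funext n
  rw [partialQuotient, stream_eq_of_chain hT h]
  rfl

open GenContFract in
lemma irrational_of_stream_ne_none {v : ℝ} (h : ∀ n, IntFractPair.stream v n ≠ none) :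
    Irrational v := by
  rintro ⟨q, hq⟩
  obtain ⟨n, hn⟩ := (IntFractPair.exists_nth_stream_eq_none_of_rat q)
  refine h n ?_
  rw [← hq]
  have := IntFractPair.coe_stream_nth_rat_eq (K := ℝ) (v := (q : ℝ)) (q := q) rfl n
  rw [hn] at this
  simpa using this.symm

open GenContFract in
lemma stream_ne_none {v : ℝ} (h : Irrational v) (n : ℕ) : IntFractPair.stream v n ≠ none := by
  intro hn
  have : (GenContFract.of v).Terminates := by
    rcases n with _ | n
    · simp [IntFractPair.stream] at hn
    · exact ⟨n, of_terminatedAt_n_iff_succ_nth_intFractPair_stream_eq_none.2 hn⟩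
  obtain ⟨q, hq⟩ := (terminates_iff_rat v).1 this
  exact h ⟨q, hq.symm⟩

open GenContFract in
lemma one_le_partialQuotient {α : ℝ} (h : Irrational α) (n : ℕ) :
    1 ≤ partialQuotient α (n + 1) := by
  obtain ⟨p, hp⟩ := Option.ne_none_iff_exists'.1 (stream_ne_none h (n + 1))
  rw [partialQuotient, hp]
  exact IntFractPair.one_le_succ_nth_stream_b hp

/-- Every sequence of positive integers is the sequence of partial quotients of an irrational. -/
lemma exists_irrational_partialQuotient_eq {x : ℕ → ℤ} (hx : ∀ k, 1 ≤ x k) :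
    ∃ α, Irrational α ∧ partialQuotient α = x := by
  have h1 : ∀ k, rightCF x k = x k + (rightCF x (k + 1))⁻¹ := fun k => rightCF_eq fun j _ => hx j
  have h2 : ∀ k, 1 < rightCF x k := fun k => by
    have h0 : (1 : ℝ) ≤ x k := by exact_mod_cast hx k
    have := one_le_rightCF (n := k + 1) fun j _ => hx j
    have := inv_pos.2 (zero_lt_one.trans_le this)
    rw [h1]; linarith
  refine ⟨rightCF x 0, irrational_of_stream_ne_none fun n => ?_, partialQuotient_eq_of_chain h2 h1⟩
  rw [stream_eq_of_chain h2 h1]; simp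

/-! ### Nonnegativity of the spectrum and a criterion for the upper limit -/

lemma rhoTerm_nonneg {α : ℝ} (h : Irrational α) (n : ℕ) : 0 ≤ rhoTerm α (n + 1) := by
  set x := partialQuotient α
  have hx : ∀ k, 1 ≤ k → 1 ≤ x k := fun k hk => by
    obtain ⟨j, rfl⟩ := Nat.exists_eq_add_of_le' hk
    exact one_le_partialQuotient h j
  have hr := one_le_rightCF (x := x) (n := n + 1 + 1) fun k hk => hx k (by omega)
  have hl : 0 ≤ leftCF x (n + 1) := by
    induction n with
    | zero =>
      have h1 : (1 : ℝ) ≤ x 1 := by exact_mod_cast hx 1 le_rfl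
      rw [leftCF_succ, leftCF_zero]
      -- The digit x_0 may be zero or negative. A nonzero integer has inverse at least -1, which x_1
      -- ≥ 1 compensates, and for x_0 = 0 the convention 0⁻¹ = 0 applies.
      rcases lt_trichotomy (x 0) 0 with h0 | h0 | h0
      · have : (x 0 : ℝ) ≤ -1 := by exact_mod_cast (by omega : x 0 ≤ -1)
        have : -1 ≤ (x 0 : ℝ)⁻¹ := by
          rw [← neg_le_neg_iff, neg_neg, ← inv_neg]
          exact inv_le_one_of_one_le₀ (by linarith)
        simp only [zero_add]; linarith
      · rw [h0]
        simp only [zero_add, Int.cast_zero, inv_zero, add_zero]; linarith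
      · have : (0 : ℝ) < x 0 := by exact_mod_cast h0
        have := inv_pos.2 this
        simp only [zero_add]; linarith
    | succ n ih =>
      have h1 : (1 : ℝ) ≤ x (n + 1 + 1) := by exact_mod_cast hx _ (by omega)
      have := inv_nonneg.2 (ih (one_le_rightCF fun k hk => hx k (by omega)))
      rw [leftCF_succ]; linarith
  rw [rhoTerm_eq]
  exact mul_nonneg hl (by linarith)

lemma nonneg_of_mem_rhoSpectrum {r : ℝ} (h : r ∈ rhoSpectrum) : 0 ≤ r := by
  obtain ⟨α, hα, hr⟩ := h
  have : (0 : EReal) ≤ rho α := by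
    refine le_limsup_of_frequently_le (Eventually.frequently ?_) (by isBoundedDefault)
    filter_upwards [eventually_ge_atTop 1] with n hn
    obtain ⟨j, rfl⟩ := Nat.exists_eq_add_of_le' hn
    exact_mod_cast rhoTerm_nonneg hα j
  rw [hr] at this
  exact_mod_cast this

lemma limsup_coe_eq {f : ℕ → ℝ} {c : ℕ → ℕ} {z : ℝ} (hc : Tendsto c atTop atTop)
    (hfc : Tendsto (fun n => f (c n)) atTop (𝓝 z)) (hf : ∀ ε > 0, ∀ᶠ n in atTop, f n ≤ z + ε) :
    limsup (fun n => (f n : EReal)) atTop = z := by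
  apply le_antisymm
  · refine EReal.le_of_forall_lt_iff_le.1 fun w hw => ?_
    have hw' : z < w := by exact_mod_cast hw
    refine limsup_le_of_le (by isBoundedDefault) ?_
    filter_upwards [hf (w - z) (by linarith)] with n hn
    exact_mod_cast (by linarith : f n ≤ w)
  · have h1 : Tendsto (fun n => (f (c n) : EReal)) atTop (𝓝 (z : EReal)) :=
      (continuous_coe_real_ereal.tendsto z).comp hfc
    rw [← h1.limsup_eq]
    have : limsup (fun n => (f (c n) : EReal)) atTop =
        limsup (fun n => (f n : EReal)) (map c atTop) := rfl
    rw [this]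
    exact limsup_le_limsup_of_le hc (by isBoundedDefault) (by isBoundedDefault)

/-! ### Thick Cantor sets and the multiplicative gap lemma -/

/-- A binary tree of intervals `[lo n, hi n]` with left and right children `l n`, `r n`. -/
structure IntervalTree (N : Type*) where
  lo : N → ℝ
  hi : N → ℝ
  l : N → N
  r : N → N

namespace IntervalTree

variable {N : Type*} (𝒯 : IntervalTree N)

/-- The multiplicative size of an interval. -/
def size (n : N) : ℝ := 𝒯.hi n / 𝒯.lo n

/-- The multiplicative size of the gap between the two children of an interval. -/
def gap (n : N) : ℝ := 𝒯.lo (𝒯.r n) / 𝒯.hi (𝒯.l n)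

/-- The union of the intervals at depth `k` below `n`. -/
def level : ℕ → N → Set ℝ
  | 0, n => Set.Icc (𝒯.lo n) (𝒯.hi n)
  | k + 1, n => level k (𝒯.l n) ∪ level k (𝒯.r n)

/-- The Cantor set below the node `n`. -/
def limitSet (n : N) : Set ℝ := ⋂ k, 𝒯.level k n

/-- On the nodes satisfying `V`, the children of an interval are obtained by removing an open
interval which is not longer, on the logarithmic scale, than each of the two children, nor longer
than the gap of the parent. -/
structure IsThick (V : N → Prop) : Prop where
  valid_l : ∀ n, V n → V (𝒯.l n)
  valid_r : ∀ n, V n → V (𝒯.r n)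
  lo_pos : ∀ n, V n → 0 < 𝒯.lo n
  lo_le_hi : ∀ n, V n → 𝒯.lo n ≤ 𝒯.hi n
  lo_l : ∀ n, V n → 𝒯.lo (𝒯.l n) = 𝒯.lo n
  hi_r : ∀ n, V n → 𝒯.hi (𝒯.r n) = 𝒯.hi n
  hi_l_le : ∀ n, V n → 𝒯.hi (𝒯.l n) ≤ 𝒯.hi n
  lo_le_r : ∀ n, V n → 𝒯.lo n ≤ 𝒯.lo (𝒯.r n)
  gap_le_size_l : ∀ n, V n → 𝒯.gap n ≤ 𝒯.size (𝒯.l n)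
  gap_le_size_r : ∀ n, V n → 𝒯.gap n ≤ 𝒯.size (𝒯.r n)
  gap_l_le : ∀ n, V n → 𝒯.gap (𝒯.l n) ≤ 𝒯.gap n
  gap_r_le : ∀ n, V n → 𝒯.gap (𝒯.r n) ≤ 𝒯.gap n

variable {𝒯}

lemma isCompact_level : ∀ (k : ℕ) (n : N), IsCompact (𝒯.level k n)
  | 0, _ => isCompact_Icc
  | k + 1, _ => (isCompact_level k _).union (isCompact_level k _)

namespace IsThick

variable {V : N → Prop} (h : 𝒯.IsThick V)
include h

lemma level_succ_subset : ∀ (k : ℕ) (n : N), V n → 𝒯.level (k + 1) n ⊆ 𝒯.level k n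
  | 0, n, hn => Set.union_subset
      (Set.Icc_subset_Icc (h.lo_l n hn).ge (h.hi_l_le n hn))
      (Set.Icc_subset_Icc (h.lo_le_r n hn) (h.hi_r n hn).le)
  | k + 1, n, hn => Set.union_subset_union (level_succ_subset k _ (h.valid_l n hn))
      (level_succ_subset k _ (h.valid_r n hn))

lemma level_antitone {n : N} (hn : V n) : Antitone fun k => 𝒯.level k n :=
  antitone_nat_of_succ_le fun k => h.level_succ_subset k n hn

lemma limitSet_subset {n : N} (hn : V n) :
    𝒯.limitSet n ⊆ 𝒯.limitSet (𝒯.l n) ∪ 𝒯.limitSet (𝒯.r n) := by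
  intro x hx
  by_contra hc
  simp only [limitSet, Set.mem_union, Set.mem_iInter, not_or, not_forall] at hc hx
  obtain ⟨⟨k, hk⟩, j, hj⟩ := hc
  rcases hx (max k j + 1) with h1 | h1
  · exact hk (h.level_antitone (h.valid_l n hn) (le_max_left k j) h1)
  · exact hj (h.level_antitone (h.valid_r n hn) (le_max_right k j) h1)

omit h in
lemma exists_mul_eq_of_Icc {a b c d z : ℝ} (ha : 0 < a) (hab : a ≤ b) (hc : 0 < c) (hcd : c ≤ d)
    (h1 : a * c ≤ z) (h2 : z ≤ b * d) : ∃ x ∈ Set.Icc a b, ∃ y ∈ Set.Icc c d, x * y = z := by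
  rcases le_total z (b * c) with h3 | h3
  · exact ⟨z / c, ⟨by rwa [le_div_iff₀ hc], by rwa [div_le_iff₀ hc]⟩, c, ⟨le_rfl, hcd⟩,
      div_mul_cancel₀ _ hc.ne'⟩
  · have hb := ha.trans_le hab
    refine ⟨b, ⟨hab, le_rfl⟩, z / b, ⟨?_, ?_⟩, mul_div_cancel₀ _ hb.ne'⟩
    · rw [le_div_iff₀ hb]; linarith
    · rw [div_le_iff₀ hb]; linarith

/-- The two product intervals obtained by splitting n leave no hole between them exactly when lo(r)
· lo(n') ≤ hi(l) · hi(n'), and this is the inequality between the gap of n and the size of n'. -/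
lemma hull_split {n n' : N} (hn : V n) (hn' : V n') {z : ℝ} (hg : 𝒯.gap n ≤ 𝒯.size n')
    (h1 : 𝒯.lo n * 𝒯.lo n' ≤ z) (h2 : z ≤ 𝒯.hi n * 𝒯.hi n') :
    (𝒯.lo (𝒯.l n) * 𝒯.lo n' ≤ z ∧ z ≤ 𝒯.hi (𝒯.l n) * 𝒯.hi n') ∨
    (𝒯.lo (𝒯.r n) * 𝒯.lo n' ≤ z ∧ z ≤ 𝒯.hi (𝒯.r n) * 𝒯.hi n') := by
  rw [h.lo_l n hn, h.hi_r n hn]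
  have hl := (h.lo_pos _ (h.valid_l n hn)).trans_le (h.lo_le_hi _ (h.valid_l n hn))
  rw [gap, size, div_le_div_iff₀ hl (h.lo_pos n' hn')] at hg
  rcases le_total z (𝒯.hi (𝒯.l n) * 𝒯.hi n') with h3 | h3
  · exact Or.inl ⟨h1, h3⟩
  · exact Or.inr ⟨by linarith, h2⟩

lemma exists_mul_eq_of_Icc_level {n : N} (hn : V n) {z : ℝ} : ∀ (k : ℕ) (n' : N), V n' →
    𝒯.gap n' ≤ 𝒯.size n → 𝒯.lo n * 𝒯.lo n' ≤ z → z ≤ 𝒯.hi n * 𝒯.hi n' →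
    ∃ x ∈ 𝒯.level 0 n, ∃ y ∈ 𝒯.level k n', x * y = z
  | 0, n', hn', _, h1, h2 => exists_mul_eq_of_Icc (h.lo_pos n hn) (h.lo_le_hi n hn)
      (h.lo_pos n' hn') (h.lo_le_hi n' hn') h1 h2
  | k + 1, n', hn', hg, h1, h2 => by
    rw [mul_comm] at h1 h2
    rcases h.hull_split hn' hn hg h1 h2 with ⟨h3, h4⟩ | ⟨h3, h4⟩
    · rw [mul_comm] at h3 h4
      obtain ⟨x, hx, y, hy, hz⟩ := exists_mul_eq_of_Icc_level hn k _ (h.valid_l n' hn')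
        ((h.gap_l_le n' hn').trans hg) h3 h4
      exact ⟨x, hx, y, Or.inl hy, hz⟩
    · rw [mul_comm] at h3 h4
      obtain ⟨x, hx, y, hy, hz⟩ := exists_mul_eq_of_Icc_level hn k _ (h.valid_r n' hn')
        ((h.gap_r_le n' hn').trans hg) h3 h4
      exact ⟨x, hx, y, Or.inr hy, hz⟩

/-- Induction on the total depth, keeping the gap of each node at most the size of the other. If
both children of n are still as large as the gap of n', then n is split. Otherwise n' has the larger
gap and is split: by thickness its children are as large as its own gap, hence as that of n. -/
lemma exists_mul_eq_of_level {z : ℝ} (k k' : ℕ) (n n' : N) (hn : V n) (hn' : V n')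
    (hg : 𝒯.gap n ≤ 𝒯.size n') (hg' : 𝒯.gap n' ≤ 𝒯.size n)
    (h1 : 𝒯.lo n * 𝒯.lo n' ≤ z) (h2 : z ≤ 𝒯.hi n * 𝒯.hi n') :
    ∃ x ∈ 𝒯.level k n, ∃ y ∈ 𝒯.level k' n', x * y = z := by
  match k, k' with
  | 0, k' => exact h.exists_mul_eq_of_Icc_level hn k' n' hn' hg' h1 h2
  | k + 1, 0 =>
    rw [mul_comm] at h1 h2
    obtain ⟨y, hy, x, hx, hz⟩ := h.exists_mul_eq_of_Icc_level hn' (k + 1) n hn hg h1 h2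
    exact ⟨x, hx, y, hy, by rw [mul_comm, hz]⟩
  | k + 1, k' + 1 =>
    by_cases hs : 𝒯.gap n' ≤ 𝒯.size (𝒯.l n) ∧ 𝒯.gap n' ≤ 𝒯.size (𝒯.r n)
    · rcases h.hull_split hn hn' hg h1 h2 with ⟨h3, h4⟩ | ⟨h3, h4⟩
      · obtain ⟨x, hx, y, hy, hz⟩ := exists_mul_eq_of_level k (k' + 1) _ n' (h.valid_l n hn) hn'
          ((h.gap_l_le n hn).trans hg) hs.1 h3 h4
        exact ⟨x, Or.inl hx, y, hy, hz⟩
      · obtain ⟨x, hx, y, hy, hz⟩ := exists_mul_eq_of_level k (k' + 1) _ n' (h.valid_r n hn) hn'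
          ((h.gap_r_le n hn).trans hg) hs.2 h3 h4
        exact ⟨x, Or.inr hx, y, hy, hz⟩
    · have hlt : 𝒯.gap n ≤ 𝒯.gap n' := by
        by_contra hc
        exact hs ⟨(not_le.1 hc).le.trans (h.gap_le_size_l n hn),
          (not_le.1 hc).le.trans (h.gap_le_size_r n hn)⟩
      rw [mul_comm] at h1 h2
      rcases h.hull_split hn' hn hg' h1 h2 with ⟨h3, h4⟩ | ⟨h3, h4⟩
      · rw [mul_comm] at h3 h4
        obtain ⟨x, hx, y, hy, hz⟩ := exists_mul_eq_of_level (k + 1) k' n _ hn (h.valid_l n' hn')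
          (hlt.trans (h.gap_le_size_l n' hn')) ((h.gap_l_le n' hn').trans hg') h3 h4
        exact ⟨x, hx, y, Or.inl hy, hz⟩
      · rw [mul_comm] at h3 h4
        obtain ⟨x, hx, y, hy, hz⟩ := exists_mul_eq_of_level (k + 1) k' n _ hn (h.valid_r n' hn')
          (hlt.trans (h.gap_le_size_r n' hn')) ((h.gap_r_le n' hn').trans hg') h3 h4
        exact ⟨x, hx, y, Or.inr hy, hz⟩
termination_by k + k'

/-- The product of two thick Cantor sets is an interval (a multiplicative form of Newhouse's gap
lemma). -/
theorem exists_mul_eq {z : ℝ} {n n' : N} (hn : V n) (hn' : V n')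
    (hg : 𝒯.gap n ≤ 𝒯.size n') (hg' : 𝒯.gap n' ≤ 𝒯.size n)
    (h1 : 𝒯.lo n * 𝒯.lo n' ≤ z) (h2 : z ≤ 𝒯.hi n * 𝒯.hi n') :
    ∃ x ∈ 𝒯.limitSet n, ∃ y ∈ 𝒯.limitSet n', x * y = z := by
  -- The solutions at depth k form a decreasing sequence of nonempty compact sets; a common point
  -- solves the equation in the limit sets.
  let K : ℕ → Set (ℝ × ℝ) := fun k => 𝒯.level k n ×ˢ 𝒯.level k n' ∩ {p | p.1 * p.2 = z}
  have hcl : IsClosed {p : ℝ × ℝ | p.1 * p.2 = z} :=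
    isClosed_eq (continuous_fst.mul continuous_snd) continuous_const
  have hK : ∀ k, IsCompact (K k) := fun k =>
    ((isCompact_level k n).prod (isCompact_level k n')).inter_right hcl
  obtain ⟨p, hp⟩ := IsCompact.nonempty_iInter_of_sequence_nonempty_isCompact_isClosed K
    (fun k => Set.inter_subset_inter_left _ (Set.prod_mono (h.level_succ_subset k n hn)
      (h.level_succ_subset k n' hn')))
    (fun k => by
      obtain ⟨x, hx, y, hy, hz⟩ := h.exists_mul_eq_of_level k k n n' hn hn' hg hg' h1 h2
      exact ⟨(x, y), ⟨hx, hy⟩, hz⟩) (hK 0) (fun k => (hK k).isClosed)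
  rw [Set.mem_iInter] at hp
  exact ⟨p.1, Set.mem_iInter.2 fun k => (hp k).1.1, p.2, Set.mem_iInter.2 fun k => (hp k).1.2,
    (hp 0).2⟩

end IsThick

end IntervalTree

/-! ### Words avoiding 44 and 41414, and their extreme values -/

/-- What has to be remembered of a word in the letters `1, 2, 3, 4` in order to avoid the factors
`44` and `41414`: the longest suffix among `∅, 4, 41, 414, 4141`. -/
inductive Suffix
  | none | s4 | s41 | s414 | s4141

namespace Suffix

/-- The largest letter that may follow. -/
def maxDigit : Suffix → ℕ
  | none => 4
  | s4 => 3
  | s41 => 4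
  | s414 => 3
  | s4141 => 3

/-- The suffix after one more letter. -/
def next : Suffix → ℕ → Suffix
  | none, j => if j = 4 then s4 else none
  | s4, j => if j = 1 then s41 else none
  | s41, j => if j = 4 then s414 else none
  | s414, j => if j = 1 then s4141 else none
  | s4141, _ => none

end Suffix

/-- The continued fraction with period `3, 1, 4, 1, 4, 1`. -/
def kappa : ℝ := (105 + √26565) / 70

/-- This is the fixed-point equation κ = (134 κ + 111) / (35 κ + 29) of the period. -/
lemma kappa_quadratic : 35 * kappa ^ 2 = 105 * kappa + 111 := by
  have := Real.sq_sqrt (show (0 : ℝ) ≤ 26565 by norm_num)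
  rw [kappa]; linarith

lemma lt_kappa : 3.8283 < kappa := by
  have : (162.985 : ℝ) < √26565 := Real.lt_sqrt_of_sq_lt (by norm_num)
  rw [kappa]; linarith

lemma kappa_lt : kappa < 3.8285 := by
  have : √26565 < (162.99 : ℝ) := (Real.sqrt_lt' (by norm_num)).2 (by norm_num)
  rw [kappa]; linarith

namespace Suffix

/-- The least value of `[0; j_1, j_2, …]` over the words allowed after a suffix. -/
def low : Suffix → ℝ
  | none => (6 * kappa + 5) / (29 * kappa + 24)
  | s4 => 1 / kappa
  | s41 => (kappa + 1) / (5 * kappa + 4)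
  | s414 => 1 / kappa
  | s4141 => 1 / kappa

/-- The largest value of `[0; j_1, j_2, …]` over the words allowed after a suffix. -/
def high : Suffix → ℝ
  | none => kappa - 3
  | s4 => (5 * kappa + 4) / (6 * kappa + 5)
  | s41 => kappa - 3
  | s414 => kappa / (kappa + 1)
  | s4141 => kappa - 3

/-- Inversion reverses the order: the least value uses the largest permitted digit followed by the
largest tail. Dually, `high_eq` uses the digit 1 followed by the least tail. -/
lemma low_eq (s : Suffix) : low s = 1 / (s.maxDigit + high (s.next s.maxDigit)) := by
  have h1 := lt_kappa
  have h2 := kappa_quadratic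
  cases s <;> simp [low, high, maxDigit, next] <;> field_simp <;> ring

lemma high_eq (s : Suffix) : high s = 1 / (1 + low (s.next 1)) := by
  have h1 := lt_kappa
  have h2 := kappa_quadratic
  have h3 : 29 * kappa + 24 ≠ 0 := by linarith
  have h4 : 5 * kappa + 4 ≠ 0 := by linarith
  have h5 : 35 * kappa + 29 ≠ 0 := by linarith
  have h6 : 6 * kappa + 5 ≠ 0 := by linarith
  have h7 : kappa + 1 ≠ 0 := by linarith
  have h8 : kappa ≠ 0 := by linarith
  have e1 : 1 + (6 * kappa + 5) / (29 * kappa + 24) =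
    (35 * kappa + 29) / (29 * kappa + 24) := by field_simp; ring
  have e2 : 1 + (kappa + 1) / (5 * kappa + 4) = (6 * kappa + 5) / (5 * kappa + 4) := by
    field_simp; ring
  have e3 : 1 + 1 / kappa = (kappa + 1) / kappa := by field_simp
  have e4 : kappa - 3 = (29 * kappa + 24) / (35 * kappa + 29) := by
    rw [eq_div_iff h5]; linarith
  cases s <;> simp only [low, high, next, if_true, if_false, e1, e2, e3,
    one_div_div, e4, OfNat.one_ne_ofNat]

lemma low_none_bounds : 0.2071 < low none ∧ low none < 0.2073 := by
  have h1 := lt_kappa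
  have h2 := kappa_lt
  rw [low, lt_div_iff₀ (by linarith), div_lt_iff₀ (by linarith)]
  constructor <;> linarith

lemma inv_kappa_bounds : 0.2611 < 1 / kappa ∧ 1 / kappa < 0.2613 := by
  have h1 := lt_kappa
  have h2 := kappa_lt
  rw [lt_div_iff₀ (by linarith), div_lt_iff₀ (by linarith)]
  constructor <;> linarith

lemma low_s41_bounds : 0.208 < low s41 ∧ low s41 < 0.209 := by
  have h1 := lt_kappa
  have h2 := kappa_lt
  rw [low, lt_div_iff₀ (by linarith), div_lt_iff₀ (by linarith)]
  constructor <;> linarith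

lemma high_s4_bounds : 0.8273 < high s4 ∧ high s4 < 0.8275 := by
  have h1 := lt_kappa
  have h2 := kappa_lt
  rw [high, lt_div_iff₀ (by linarith), div_lt_iff₀ (by linarith)]
  constructor <;> linarith

lemma high_s414_bounds : 0.7928 < high s414 ∧ high s414 < 0.793 := by
  have h1 := lt_kappa
  have h2 := kappa_lt
  rw [high, lt_div_iff₀ (by linarith), div_lt_iff₀ (by linarith)]
  constructor <;> linarith

lemma low_bounds (s : Suffix) : 0.207 ≤ low s ∧ low s ≤ 0.262 := by
  have h1 := low_none_bounds
  have h2 := low_s41_bounds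
  have h3 := inv_kappa_bounds
  cases s
  · constructor <;> linarith
  · rw [low]; constructor <;> linarith
  · constructor <;> linarith
  · rw [low]; constructor <;> linarith
  · rw [low]; constructor <;> linarith

lemma high_bounds (s : Suffix) : 0.79 ≤ high s ∧ high s ≤ 0.829 := by
  have h1 := high_s4_bounds
  have h2 := high_s414_bounds
  have h3 := lt_kappa
  have h4 := kappa_lt
  cases s
  · rw [high]; constructor <;> linarith
  · constructor <;> linarith
  · rw [high]; constructor <;> linarith
  · constructor <;> linarith
  · rw [high]; constructor <;> linarith

lemma maxDigit_le (s : Suffix) : s.maxDigit ≤ 4 := by cases s <;> simp [maxDigit]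

lemma le_maxDigit (s : Suffix) : 3 ≤ s.maxDigit := by cases s <;> simp [maxDigit]

lemma next_eq_s4 {s : Suffix} {j : ℕ} (h : s.next j = s4) : j = 4 := by
  cases s <;> simp only [next] at h <;> (try split_ifs at h) <;> first | assumption | cases h

lemma next_eq_s41 {s : Suffix} {j : ℕ} (h : s.next j = s41) : s = s4 ∧ j = 1 := by
  cases s <;> simp only [next] at h <;> (try split_ifs at h) <;>
    first | exact ⟨rfl, by assumption⟩ | cases h

/-- The size of the last gap against the size of the interval of the largest digit. -/
lemma last_gap_le {s : Suffix} {i : ℕ} (hi : i + 1 = s.maxDigit) (c : ℝ)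
    (hc : c = 0 ∨ c = 4 / 5) (hs : s = s41 → c = 4 / 5) :
    (i + 1 + low (s.next (i + 1)) - (i + high (s.next i))) *
        (s.maxDigit + high (s.next s.maxDigit) + c) ≤
      (s.maxDigit + high (s.next s.maxDigit) - (i + 1 + low (s.next (i + 1)))) *
        (i + high (s.next i) + c) := by
  have h1 := high_s4_bounds
  have h2 := high_s414_bounds
  have h3 := lt_kappa
  have h4 := kappa_lt
  have h5 := low_none_bounds
  have h6 := inv_kappa_bounds
  have key : ∀ g D h B g' D' h' B' : ℝ, g ≤ g' → D ≤ D' → h' ≤ h → B' ≤ B → 0 ≤ D → 0 ≤ g' →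
      0 ≤ B' → 0 ≤ h → g' * D' ≤ h' * B' → g * D ≤ h * B := by
    intro g D h B g' D' h' B' a1 a2 a3 a4 a5 a6 a7 a8 a9
    exact (mul_le_mul a1 a2 a5 a6).trans (a9.trans (mul_le_mul a3 a4 a7 a8))
  cases s
  · obtain rfl : i = 3 := by simpa [maxDigit] using hi
    simp only [next, maxDigit, Nat.reduceAdd, Nat.reduceEqDiff, if_true, if_false]
    simp only [show low s4 = 1 / kappa from rfl, show high none = kappa - 3 from rfl]
    push_cast
    refine key _ _ _ _ 0.433 (4.8275 + c) 0.566 (3.8283 + c) ?_ ?_ ?_ ?_ ?_ ?_ ?_ ?_ ?_ <;>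
      rcases hc with rfl | rfl <;> linarith
  · obtain rfl : i = 2 := by simpa [maxDigit] using hi
    simp only [next, maxDigit, Nat.reduceAdd, if_false, OfNat.ofNat_ne_one]
    simp only [show high none = kappa - 3 from rfl]
    push_cast
    refine key _ _ _ _ 0.379 (3.8285 + c) 0.621 (2.8283 + c) ?_ ?_ ?_ ?_ ?_ ?_ ?_ ?_ ?_ <;>
      rcases hc with rfl | rfl <;> linarith
  -- The tight case. After 41 the branch of the digit 4 is shortened, because 414 followed by 1
  -- forbids another 4. The inequality fails here for c = 0.
  · obtain rfl : i = 3 := by simpa [maxDigit] using hi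
    obtain rfl := hs rfl
    simp only [next, maxDigit, Nat.reduceAdd, Nat.reduceEqDiff, if_true, if_false]
    simp only [show low s414 = 1 / kappa from rfl, show high none = kappa - 3 from rfl]
    push_cast
    refine key _ _ _ _ 0.433 (4.793 + 4 / 5) 0.5315 (3.8283 + 4 / 5) ?_ ?_ ?_ ?_ ?_ ?_ ?_ ?_ ?_ <;>
      linarith
  · obtain rfl : i = 2 := by simpa [maxDigit] using hi
    simp only [next, maxDigit, Nat.reduceAdd, if_false, OfNat.ofNat_ne_one]
    simp only [show high none = kappa - 3 from rfl]
    push_cast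
    refine key _ _ _ _ 0.379 (3.8285 + c) 0.621 (2.8283 + c) ?_ ?_ ?_ ?_ ?_ ?_ ?_ ?_ ?_ <;>
      rcases hc with rfl | rfl <;> linarith
  · obtain rfl : i = 2 := by simpa [maxDigit] using hi
    simp only [next, maxDigit]
    simp only [show high none = kappa - 3 from rfl]
    push_cast
    refine key _ _ _ _ 0.379 (3.8285 + c) 0.621 (2.8283 + c) ?_ ?_ ?_ ?_ ?_ ?_ ?_ ?_ ?_ <;>
      rcases hc with rfl | rfl <;> linarith

end Suffix

/-! ### Möbius images of the digit intervals and their thickness -/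

/-- The interval of all `(P t + P') / (Q t + Q')` where `t = [j_0; j_1, …]` runs over the words
allowed after the suffix `s` with `i ≤ j_0`. -/
structure CFNode where
  P : ℝ
  P' : ℝ
  Q : ℝ
  Q' : ℝ
  s : Suffix
  i : ℕ

namespace CFNode

variable (n : CFNode)

/-- The numerator of the Möbius map. -/
def num (t : ℝ) : ℝ := n.P * t + n.P'

/-- The denominator of the Möbius map. -/
def den (t : ℝ) : ℝ := n.Q * t + n.Q'

/-- The Möbius map. -/
def eval (t : ℝ) : ℝ := n.num t / n.den t

/-- The determinant of the Möbius map. -/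
def det : ℝ := n.P * n.Q' - n.P' * n.Q

/-- The least value of `t` with `j_0 = i`. -/
def ptA : ℝ := n.i + (n.s.next n.i).low

/-- The largest value of `t` with `j_0 = i`. -/
def ptB : ℝ := n.i + (n.s.next n.i).high

/-- The least value of `t` with `j_0 = i + 1`. -/
def ptC : ℝ := n.i + 1 + (n.s.next (n.i + 1)).low

/-- The largest value of `t`. -/
def ptD : ℝ := n.s.maxDigit + (n.s.next n.s.maxDigit).high

/-- The node of the words which begin with `j`. -/
def digit (j : ℕ) : CFNode :=
  ⟨n.P * j + n.P', n.P, n.Q * j + n.Q', n.Q, n.s.next j, 1⟩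

/-- The node of the words with `i < j_0`. -/
def rest : CFNode :=
  if n.i + 1 < n.s.maxDigit then ⟨n.P, n.P', n.Q, n.Q', n.s, n.i + 1⟩ else n.digit (n.i + 1)

/-- Matrices of the form `(P, P'; Q, Q')` that occur for continued fractions. -/
def RowValid (s : Suffix) (P P' : ℝ) : Prop :=
  0 < P ∧ 0 ≤ P' ∧ P' ≤ P ∧ (s = .s4 → 4 * P' ≤ P) ∧ (s = .s41 → 4 * P ≤ 5 * P')

/-- The conditions on the nodes that occur. -/
structure Valid : Prop where
  rowP : RowValid n.s n.P n.P'
  rowQ : RowValid n.s n.Q n.Q'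
  det_ne : n.det ≠ 0
  one_le : 1 ≤ n.i
  lt_max : n.i < n.s.maxDigit

/-- A digit 4 gives P ≥ 4 P' in the new row. A subsequent digit 1 turns the ratio P' / P into P / (P
+ P'), which is then at least 4/5; this is the shift that the tight state `s41` needs. -/
lemma RowValid.digit {s : Suffix} {P P' : ℝ} (h : RowValid s P P') {j : ℕ} (hj : 1 ≤ j) :
    RowValid (s.next j) (P * j + P') P := by
  obtain ⟨h1, h2, h3, h4, h5⟩ := h
  have hj' : (1 : ℝ) ≤ j := by exact_mod_cast hj
  refine ⟨by nlinarith, h1.le, by nlinarith, fun h => ?_, fun h => ?_⟩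
  · rw [Suffix.next_eq_s4 h]; push_cast; linarith
  · obtain ⟨hs, rfl⟩ := Suffix.next_eq_s41 h
    have := h4 hs
    push_cast; linarith

variable {n}

lemma det_digit (j : ℕ) : (n.digit j).det = -n.det := by
  simp only [det, digit]; ring

lemma Valid.digit (h : n.Valid) {j : ℕ} (hj : 1 ≤ j) : (n.digit j).Valid where
  rowP := h.rowP.digit hj
  rowQ := h.rowQ.digit hj
  det_ne := by rw [det_digit]; exact neg_ne_zero.2 h.det_ne
  one_le := le_rfl
  lt_max := by
    have := (n.s.next j).le_maxDigit
    simp only [CFNode.digit]; omega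

lemma Valid.rest (h : n.Valid) : n.rest.Valid := by
  unfold CFNode.rest
  split_ifs with h1
  · exact ⟨h.rowP, h.rowQ, h.det_ne, by simp, h1⟩
  · exact h.digit (by omega)

lemma num_digit (j : ℕ) {t : ℝ} (ht : 0 < t) : (n.digit j).num t = t * n.num (j + 1 / t) := by
  simp only [num, digit]; field_simp; ring

lemma den_digit (j : ℕ) {t : ℝ} (ht : 0 < t) : (n.digit j).den t = t * n.den (j + 1 / t) := by
  simp only [den, digit]; field_simp; ring

lemma eval_digit (j : ℕ) {t : ℝ} (ht : 0 < t) : (n.digit j).eval t = n.eval (j + 1 / t) := by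
  rw [eval, eval, num_digit j ht, den_digit j ht, mul_div_mul_left _ _ ht.ne']

lemma Valid.num_pos (h : n.Valid) {t : ℝ} (ht : 0 < t) : 0 < n.num t := by
  have := mul_pos h.rowP.1 ht
  have := h.rowP.2.1
  rw [num]; linarith

lemma Valid.den_pos (h : n.Valid) {t : ℝ} (ht : 0 < t) : 0 < n.den t := by
  have := mul_pos h.rowQ.1 ht
  have := h.rowQ.2.1
  rw [den]; linarith

lemma num_mul_den_sub (t u : ℝ) :
    n.num u * n.den t - n.num t * n.den u = n.det * (u - t) := by
  simp only [num, den, det]; ring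

lemma Valid.eval_le_eval (h : n.Valid) (hd : 0 ≤ n.det) {t u : ℝ} (ht : 0 < t) (htu : t ≤ u) :
    n.eval t ≤ n.eval u := by
  rw [eval, eval, div_le_div_iff₀ (h.den_pos ht) (h.den_pos (ht.trans_le htu))]
  have := num_mul_den_sub (n := n) t u
  nlinarith [mul_nonneg hd (sub_nonneg.2 htu)]

lemma Valid.eval_le_eval_of_neg (h : n.Valid) (hd : n.det ≤ 0) {t u : ℝ} (ht : 0 < t)
    (htu : t ≤ u) : n.eval u ≤ n.eval t := by
  rw [eval, eval, div_le_div_iff₀ (h.den_pos (ht.trans_le htu)) (h.den_pos ht)]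
  have := num_mul_den_sub (n := n) t u
  nlinarith [mul_nonneg (neg_nonneg.2 hd) (sub_nonneg.2 htu)]

lemma Valid.eval_injOn (h : n.Valid) {t u : ℝ} (ht : 0 < t) (hu : 0 < u)
    (he : n.eval t = n.eval u) : t = u := by
  rw [eval, eval, div_eq_div_iff (h.den_pos ht).ne' (h.den_pos hu).ne'] at he
  have := num_mul_den_sub (n := n) u t
  have h0 : n.det * (t - u) = 0 := by linarith
  have := (mul_eq_zero.1 h0).resolve_left h.det_ne
  linarith

lemma Valid.eval_pos (h : n.Valid) {t : ℝ} (ht : 0 < t) : 0 < n.eval t :=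
  div_pos (h.num_pos ht) (h.den_pos ht)

lemma ptA_digit (j : ℕ) : (n.digit j).ptA = 1 / (n.s.next j).high := by
  rw [Suffix.high_eq]; simp [ptA, digit]

lemma ptD_digit (j : ℕ) : (n.digit j).ptD = 1 / (n.s.next j).low := by
  rw [Suffix.low_eq]; simp [ptD, digit]

lemma eval_ptA_digit (j : ℕ) : (n.digit j).eval (n.digit j).ptA =
    n.eval (j + (n.s.next j).high) := by
  have := (n.s.next j).high_bounds
  rw [ptA_digit, eval_digit j (one_div_pos.2 (by linarith)), one_div_one_div]

lemma eval_ptD_digit (j : ℕ) : (n.digit j).eval (n.digit j).ptD =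
    n.eval (j + (n.s.next j).low) := by
  have := (n.s.next j).low_bounds
  rw [ptD_digit, eval_digit j (one_div_pos.2 (by linarith)), one_div_one_div]

variable (n) in
lemma pt_bounds (hi : 1 ≤ n.i) : (n.i + 0.207 ≤ n.ptA ∧ n.ptA ≤ n.i + 0.262) ∧
    (n.i + 0.79 ≤ n.ptB ∧ n.ptB ≤ n.i + 0.829) ∧ (n.i + 1.207 ≤ n.ptC ∧ n.ptC ≤ n.i + 1.262) ∧
    (n.s.maxDigit + 0.79 ≤ n.ptD ∧ n.ptD ≤ n.s.maxDigit + 0.829) ∧ (1 : ℝ) ≤ n.i := by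
  have h1 := (n.s.next n.i).low_bounds
  have h2 := (n.s.next n.i).high_bounds
  have h3 := (n.s.next (n.i + 1)).low_bounds
  have h4 := (n.s.next n.s.maxDigit).high_bounds
  have h5 : (1 : ℝ) ≤ n.i := by exact_mod_cast hi
  refine ⟨⟨?_, ?_⟩, ⟨?_, ?_⟩, ⟨?_, ?_⟩, ⟨?_, ?_⟩, h5⟩ <;> simp only [ptA, ptB, ptC, ptD] <;> linarith

/-- The tree of intervals. -/
def tree : IntervalTree CFNode where
  lo n := if 0 < n.det then n.eval n.ptA else n.eval n.ptD
  hi n := if 0 < n.det then n.eval n.ptD else n.eval n.ptA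
  l n := if 0 < n.det then n.digit n.i else n.rest
  r n := if 0 < n.det then n.rest else n.digit n.i

lemma Valid.det_neg (h : n.Valid) (hd : ¬ 0 < n.det) : n.det < 0 :=
  lt_of_le_of_ne (not_lt.1 hd) h.det_ne

lemma tree_lo_digit_of_pos (j : ℕ) (hd : 0 < n.det) :
    tree.lo (n.digit j) = n.eval (j + (n.s.next j).low) := by
  have : ¬ 0 < (n.digit j).det := by rw [det_digit]; linarith
  simp only [tree, if_neg this, eval_ptD_digit]

lemma tree_hi_digit_of_pos (j : ℕ) (hd : 0 < n.det) :
    tree.hi (n.digit j) = n.eval (j + (n.s.next j).high) := by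
  have : ¬ 0 < (n.digit j).det := by rw [det_digit]; linarith
  simp only [tree, if_neg this, eval_ptA_digit]

lemma tree_lo_digit_of_neg (j : ℕ) (hd : n.det < 0) :
    tree.lo (n.digit j) = n.eval (j + (n.s.next j).high) := by
  have : 0 < (n.digit j).det := by rw [det_digit]; linarith
  simp only [tree, if_pos this, eval_ptA_digit]

lemma tree_hi_digit_of_neg (j : ℕ) (hd : n.det < 0) :
    tree.hi (n.digit j) = n.eval (j + (n.s.next j).low) := by
  have : 0 < (n.digit j).det := by rw [det_digit]; linarith
  simp only [tree, if_pos this, eval_ptD_digit]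

/-- When only the largest digit is left, `rest` is the node of that digit, with opposite
determinant; its hull still has the images of C and D as end points, so both forms of `rest` can be
treated alike. -/
lemma Valid.tree_rest (h : n.Valid) :
    tree.lo n.rest = (if 0 < n.det then n.eval n.ptC else n.eval n.ptD) ∧
    tree.hi n.rest = (if 0 < n.det then n.eval n.ptD else n.eval n.ptC) := by
  by_cases h1 : n.i + 1 < n.s.maxDigit
  · simp [CFNode.rest, if_pos h1, tree, det, eval, num, den, ptA, ptC, ptD]
  · have h2 : n.s.maxDigit = n.i + 1 := by have := h.lt_max; omega
    simp only [CFNode.rest, if_neg h1]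
    by_cases hd : 0 < n.det
    · simp only [if_pos hd]
      rw [tree_lo_digit_of_pos _ hd, tree_hi_digit_of_pos _ hd, ptC, ptD, h2]
      simp
    · simp only [if_neg hd]
      rw [tree_lo_digit_of_neg _ (h.det_neg hd), tree_hi_digit_of_neg _ (h.det_neg hd), ptC, ptD,
        h2]
      simp

lemma Valid.lo_l (h : n.Valid) : tree.lo (tree.l n) = tree.lo n := by
  by_cases hd : 0 < n.det
  · have : tree.l n = n.digit n.i := by simp [tree, hd]
    rw [this, tree_lo_digit_of_pos _ hd]; simp [tree, hd, ptA]
  · have : tree.l n = n.rest := by simp [tree, hd]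
    rw [this, h.tree_rest.1]; simp [tree, hd]

lemma Valid.hi_l (h : n.Valid) : tree.hi (tree.l n) =
    if 0 < n.det then n.eval n.ptB else n.eval n.ptC := by
  by_cases hd : 0 < n.det
  · have : tree.l n = n.digit n.i := by simp [tree, hd]
    rw [this, tree_hi_digit_of_pos _ hd]; simp [hd, ptB]
  · have : tree.l n = n.rest := by simp [tree, hd]
    rw [this, h.tree_rest.2, if_neg hd, if_neg hd]

lemma Valid.lo_r (h : n.Valid) : tree.lo (tree.r n) =
    if 0 < n.det then n.eval n.ptC else n.eval n.ptB := by
  by_cases hd : 0 < n.det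
  · have : tree.r n = n.rest := by simp [tree, hd]
    rw [this, h.tree_rest.1, if_pos hd, if_pos hd]
  · have : tree.r n = n.digit n.i := by simp [tree, hd]
    rw [this, tree_lo_digit_of_neg _ (h.det_neg hd)]; simp [hd, ptB]

lemma Valid.hi_r (h : n.Valid) : tree.hi (tree.r n) = tree.hi n := by
  by_cases hd : 0 < n.det
  · have : tree.r n = n.rest := by simp [tree, hd]
    rw [this, h.tree_rest.2]; simp [tree, hd]
  · have : tree.r n = n.digit n.i := by simp [tree, hd]
    rw [this, tree_hi_digit_of_neg _ (h.det_neg hd)]; simp [tree, hd, ptA]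

lemma Valid.pts (h : n.Valid) : 1 ≤ n.ptA ∧ n.ptA < n.ptB ∧ n.ptB < n.ptC ∧ n.ptC < n.ptD := by
  obtain ⟨⟨h1, h2⟩, ⟨h3, h4⟩, ⟨h5, h6⟩, ⟨h7, h8⟩, h9⟩ := n.pt_bounds h.one_le
  have h10 : (n.i : ℝ) + 1 ≤ n.s.maxDigit := by exact_mod_cast h.lt_max
  refine ⟨?_, ?_, ?_, ?_⟩ <;> linarith

/-- The denominator of the relative size of the gap. -/
def gapDen (n : CFNode) : ℝ :=
  if 0 < n.det then n.num n.ptB * n.den n.ptC else n.num n.ptC * n.den n.ptB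

lemma Valid.gapDen_pos (h : n.Valid) : 0 < n.gapDen := by
  obtain ⟨h1, h2, h3, -⟩ := h.pts
  have hB : 0 < n.ptB := by linarith
  have hC : 0 < n.ptC := by linarith
  rw [gapDen]
  split_ifs
  · exact mul_pos (h.num_pos hB) (h.den_pos hC)
  · exact mul_pos (h.num_pos hC) (h.den_pos hB)

/-- The cross difference of the values at B and C is det · (C - B). As |det| is constant along the
tree, comparing the gaps of a child and its parent amounts to comparing (C - B) / `gapDen`. -/
lemma Valid.gap_eq (h : n.Valid) :
    tree.gap n = 1 + |n.det| * ((n.ptC - n.ptB) / n.gapDen) := by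
  obtain ⟨h1, h2, h3, -⟩ := h.pts
  have hB : 0 < n.ptB := by linarith
  have hC : 0 < n.ptC := by linarith
  have e := num_mul_den_sub (n := n) n.ptB n.ptC
  have p1 := h.num_pos hB
  have p2 := h.num_pos hC
  have p3 := h.den_pos hB
  have p4 := h.den_pos hC
  rw [IntervalTree.gap, h.hi_l, h.lo_r, gapDen]
  by_cases hd : 0 < n.det
  · simp only [if_pos hd, eval, abs_of_pos hd]
    rw [← mul_div_assoc, ← e]
    field_simp; ring
  · simp only [if_neg hd, eval, abs_of_neg (h.det_neg hd)]
    rw [← mul_div_assoc, neg_mul, ← e]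
    field_simp; ring

lemma gap_le_gap {m : CFNode} (hn : n.Valid) (hm : m.Valid) (hd : |m.det| = |n.det|)
    (h : (m.ptC - m.ptB) * n.gapDen ≤ (n.ptC - n.ptB) * m.gapDen) : tree.gap m ≤ tree.gap n := by
  rw [hn.gap_eq, hm.gap_eq, hd]
  have := (div_le_div_iff₀ hm.gapDen_pos hn.gapDen_pos).2 h
  nlinarith [abs_nonneg n.det]

/-- Comparison of two products of linear forms, up to the factor `0.378 / 0.472`. -/
lemma mul_le_of_rows {u v g g' a b a' b' : ℝ} (hg : 0.378 ≤ g) (hg' : g' ≤ 0.472) (ha : 0 < a)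
    (hb : 0 < b) (hu : u * a ≤ a') (hv : v * b ≤ b') (hu0 : 0 < u) (hv0 : 0 < v)
    (huv : 0.472 ≤ 0.378 * (u * v)) : g' * (a * b) ≤ g * (a' * b') := by
  have h1 : (u * a) * (v * b) ≤ a' * b' :=
    mul_le_mul hu hv (by positivity) (le_trans (by positivity) hu)
  have h2 := mul_pos ha hb
  have h3 : 0 < a' * b' := lt_of_lt_of_le (by positivity) h1
  calc g' * (a * b) ≤ 0.472 * (a * b) := by gcongr
    _ ≤ 0.378 * (u * v) * (a * b) := by gcongr
    _ = 0.378 * ((u * a) * (v * b)) := by ring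
    _ ≤ 0.378 * (a' * b') := by gcongr
    _ ≤ g * (a' * b') := by gcongr

lemma Valid.gap_digit_le (h : n.Valid) {j : ℕ} (hj : n.i ≤ j) :
    tree.gap (n.digit j) ≤ tree.gap n := by
  have hj' : (n.i : ℝ) ≤ j := by exact_mod_cast hj
  have hm := h.digit (h.one_le.trans hj)
  refine gap_le_gap h hm (by rw [det_digit, abs_neg]) ?_
  obtain ⟨⟨h1, h2⟩, ⟨h3, h4⟩, ⟨h5, h6⟩, ⟨h7, h8⟩, h9⟩ := n.pt_bounds h.one_le
  obtain ⟨⟨k1, k2⟩, ⟨k3, k4⟩, ⟨k5, k6⟩, ⟨k7, k8⟩, k9⟩ := (n.digit j).pt_bounds hm.one_le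
  simp only [CFNode.digit, Nat.cast_one] at k3 k4 k5 k6
  change _ ≤ (n.digit j).ptB at k3
  change (n.digit j).ptB ≤ _ at k4
  change _ ≤ (n.digit j).ptC at k5
  change (n.digit j).ptC ≤ _ at k6
  have hB : 0 < n.ptB := by linarith
  have hC : 0 < n.ptC := by linarith
  -- All lengths C - B lie in [0.378, 0.472], so it is enough that the growth factors of the two
  -- rows multiply to at least 0.472 / 0.378. A digit flips the sign of the determinant, so B of the
  -- child is matched with C of the parent and conversely.
  have rB : ∀ {P P' : ℝ}, RowValid n.s P P' →
      1.2 * (P * n.ptC + P') ≤ (P * j + P') * (n.digit j).ptB + P := by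
    rintro P P' ⟨r1, r2, -⟩
    nlinarith [mul_nonneg r2 (by linarith : 0 ≤ (n.digit j).ptB - 1.79),
      mul_nonneg r1.le (by nlinarith : 0 ≤ j * (n.digit j).ptB + 1 - 1.2 * n.ptC)]
  have rC : ∀ {P P' : ℝ}, RowValid n.s P P' →
      1.6 * (P * n.ptB + P') ≤ (P * j + P') * (n.digit j).ptC + P := by
    rintro P P' ⟨r1, r2, -⟩
    nlinarith [mul_nonneg r2 (by linarith : 0 ≤ (n.digit j).ptC - 1.79),
      mul_nonneg r1.le (by nlinarith : 0 ≤ j * (n.digit j).ptC + 1 - 1.6 * n.ptB)]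
  rw [gapDen, gapDen]
  by_cases hd : 0 < n.det
  · have hd' : ¬ 0 < (n.digit j).det := by rw [det_digit]; linarith
    rw [if_pos hd, if_neg hd']
    exact mul_le_of_rows (by linarith) (by linarith) (h.num_pos hB) (h.den_pos hC) (rC h.rowP)
      (rB h.rowQ) (by norm_num) (by norm_num) (by norm_num)
  · have hd' : 0 < (n.digit j).det := by rw [det_digit]; linarith [h.det_neg hd]
    rw [if_neg hd, if_pos hd']
    exact mul_le_of_rows (by linarith) (by linarith) (h.num_pos hC) (h.den_pos hB) (rB h.rowP)
      (rC h.rowQ) (by norm_num) (by norm_num) (by norm_num)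

lemma Valid.gap_rest_le (h : n.Valid) : tree.gap n.rest ≤ tree.gap n := by
  by_cases hi : n.i + 1 < n.s.maxDigit
  swap
  · rw [CFNode.rest, if_neg hi]; exact h.gap_digit_le (by omega)
  have hm := h.rest
  obtain ⟨⟨h1, h2⟩, ⟨h3, h4⟩, ⟨h5, h6⟩, ⟨h7, h8⟩, h9⟩ := n.pt_bounds h.one_le
  obtain ⟨⟨k1, k2⟩, ⟨k3, k4⟩, ⟨k5, k6⟩, ⟨k7, k8⟩, k9⟩ := n.rest.pt_bounds hm.one_le
  have e : (n.rest.i : ℝ) = n.i + 1 := by simp [CFNode.rest, hi]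
  rw [e] at k3 k4 k5 k6
  have hdet : n.rest.det = n.det := by simp [CFNode.rest, hi, det]
  have hnum : ∀ t, n.rest.num t = n.num t := fun t => by simp [CFNode.rest, hi, num]
  have hden : ∀ t, n.rest.den t = n.den t := fun t => by simp [CFNode.rest, hi, den]
  refine gap_le_gap h hm (by rw [hdet]) ?_
  rw [gapDen, gapDen, hdet]
  simp only [hnum, hden]
  have hB : 0 < n.ptB := by linarith
  have hC : 0 < n.ptC := by linarith
  -- The relative growth from i to i + 1 decreases with i; the factors 1.25 and 1.22 rely on i ≤ 2.
  have h10 : (n.i : ℝ) ≤ 2 := by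
    have := n.s.maxDigit_le
    exact_mod_cast (by omega : n.i ≤ 2)
  have rB : ∀ {P P' : ℝ}, RowValid n.s P P' →
      1.25 * (P * n.ptB + P') ≤ P * n.rest.ptB + P' := by
    rintro P P' ⟨r1, r2, r3, -⟩
    nlinarith [mul_nonneg r1.le (by linarith : 0 ≤ n.rest.ptB - 1.25 * n.ptB - 0.25)]
  have rC : ∀ {P P' : ℝ}, RowValid n.s P P' →
      1.22 * (P * n.ptC + P') ≤ P * n.rest.ptC + P' := by
    rintro P P' ⟨r1, r2, r3, -⟩
    nlinarith [mul_nonneg r1.le (by linarith : 0 ≤ n.rest.ptC - 1.22 * n.ptC - 0.22)]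
  by_cases hd : 0 < n.det
  · simp only [if_pos hd]
    exact mul_le_of_rows (by linarith) (by linarith) (h.num_pos hB) (h.den_pos hC) (rB h.rowP)
      (rC h.rowQ) (by norm_num) (by norm_num) (by norm_num)
  · simp only [if_neg hd]
    exact mul_le_of_rows (by linarith) (by linarith) (h.num_pos hC) (h.den_pos hB) (rC h.rowP)
      (rB h.rowQ) (by norm_num) (by norm_num) (by norm_num)

/-- If P' / P ≥ c then (P C + P') / (P B + P') ≤ (C + c) / (B + c), and likewise for Q with D and C.
The product of the two bounds telescopes to (D + c) / (B + c). -/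
lemma mul_le_of_shift {P P' Q Q' c B C D g w : ℝ} (hP : 0 < P) (hQ : 0 < Q) (hP' : c * P ≤ P')
    (hQ' : c * Q ≤ Q') (hc : 0 ≤ c) (hB : 0 < B) (hBC : B ≤ C) (hCD : C ≤ D) (hg : 0 ≤ g)
    (h : g * (D + c) ≤ w * (B + c)) :
    g * ((P * C + P') * (Q * D + Q')) ≤ w * ((P * B + P') * (Q * C + Q')) := by
  have hC : 0 < C := hB.trans_le hBC
  have hp : 0 < P * B + P' := by nlinarith [mul_pos hP hB, mul_nonneg hc hP.le]
  have hq : 0 < Q * C + Q' := by nlinarith [mul_pos hQ hC, mul_nonneg hc hQ.le]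
  have h1 : (P * C + P') * (B + c) ≤ (P * B + P') * (C + c) := by
    nlinarith [mul_nonneg (sub_nonneg.2 hP') (sub_nonneg.2 hBC)]
  have h2 : (Q * D + Q') * (C + c) ≤ (Q * C + Q') * (D + c) := by
    nlinarith [mul_nonneg (sub_nonneg.2 hQ') (sub_nonneg.2 hCD)]
  have h3 : 0 < (B + c) * (C + c) := by positivity
  have hq' : 0 ≤ Q * D + Q' := by nlinarith
  refine le_of_mul_le_mul_right ?_ h3
  calc g * ((P * C + P') * (Q * D + Q')) * ((B + c) * (C + c))
      = g * (((P * C + P') * (B + c)) * ((Q * D + Q') * (C + c))) := by ring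
    _ ≤ g * (((P * B + P') * (C + c)) * ((Q * C + Q') * (D + c))) := by
        have : 0 ≤ (Q * D + Q') * (C + c) := by positivity
        have : 0 ≤ (P * B + P') * (C + c) := by positivity
        gcongr
    _ = (g * (D + c)) * ((P * B + P') * (Q * C + Q') * (C + c)) := by ring
    _ ≤ (w * (B + c)) * ((P * B + P') * (Q * C + Q') * (C + c)) := by gcongr
    _ = w * ((P * B + P') * (Q * C + Q')) * ((B + c) * (C + c)) := by ring

/-- The shift c = 0 suffices for every split except the last one after 41, where the row condition
provides 4/5. -/
lemma Valid.gap_mul_le (h : n.Valid) : ∃ c, 0 ≤ c ∧ c * n.P ≤ n.P' ∧ c * n.Q ≤ n.Q' ∧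
    (n.ptC - n.ptB) * (n.ptD + c) ≤ (n.ptD - n.ptC) * (n.ptB + c) := by
  obtain ⟨p1, p2, p3, p4, p5⟩ := h.rowP
  obtain ⟨q1, q2, q3, q4, q5⟩ := h.rowQ
  by_cases hi : n.i + 1 < n.s.maxDigit
  · refine ⟨0, le_rfl, by linarith, by linarith, ?_⟩
    obtain ⟨⟨h1, h2⟩, ⟨h3, h4⟩, ⟨h5, h6⟩, ⟨h7, h8⟩, h9⟩ := n.pt_bounds h.one_le
    have h10 : (n.i : ℝ) + 2 ≤ n.s.maxDigit := by exact_mod_cast hi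
    have h11 : (n.s.maxDigit : ℝ) ≤ 4 := by exact_mod_cast n.s.maxDigit_le
    simp only [add_zero]
    have e1 : (n.ptC - n.ptB) * n.ptD ≤ 0.472 * 4.829 := by
      apply mul_le_mul <;> linarith
    have e2 : 1.528 * 1.79 ≤ (n.ptD - n.ptC) * n.ptB := by
      apply mul_le_mul <;> linarith
    norm_num at e1 e2; linarith
  · have hi' : n.i + 1 = n.s.maxDigit := by have := h.lt_max; omega
    by_cases hs : n.s = .s41
    · refine ⟨4 / 5, by norm_num, by linarith [p5 hs], by linarith [q5 hs], ?_⟩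
      exact Suffix.last_gap_le hi' _ (Or.inr rfl) fun _ => rfl
    · refine ⟨0, le_rfl, by linarith, by linarith, ?_⟩
      exact Suffix.last_gap_le hi' _ (Or.inl rfl) fun h => (hs h).elim

/-- The piece of the digit i is always longer than the gap: B - A ≥ 0.528 and C - B ≤ 0.472. With
denominators cleared, the two sides differ by |det| times a comparison of these lengths with
monotone weights. -/
lemma Valid.gap_le_size_digit (h : n.Valid) : tree.gap n ≤ tree.size (n.digit n.i) := by
  obtain ⟨h1, h2, h3, h4⟩ := h.pts
  obtain ⟨⟨k1, k2⟩, ⟨k3, k4⟩, ⟨k5, k6⟩, -⟩ := n.pt_bounds h.one_le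
  have pA := h.num_pos (show 0 < n.ptA by linarith)
  have qA := h.den_pos (show 0 < n.ptA by linarith)
  have pB := h.num_pos (show 0 < n.ptB by linarith)
  have qB := h.den_pos (show 0 < n.ptB by linarith)
  have pC := h.num_pos (show 0 < n.ptC by linarith)
  have qC := h.den_pos (show 0 < n.ptC by linarith)
  have mono : ∀ {t u : ℝ}, t ≤ u → n.num t ≤ n.num u ∧ n.den t ≤ n.den u := fun htu =>
    ⟨by have := mul_le_mul_of_nonneg_left htu h.rowP.1.le; simp only [num]; linarith,
      by have := mul_le_mul_of_nonneg_left htu h.rowQ.1.le; simp only [den]; linarith⟩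
  have hg : n.ptC - n.ptB ≤ n.ptB - n.ptA := by linarith
  rw [IntervalTree.gap, IntervalTree.size, h.hi_l, h.lo_r]
  by_cases hd : 0 < n.det
  · rw [tree_lo_digit_of_pos _ hd, tree_hi_digit_of_pos _ hd]
    change _ ≤ n.eval n.ptB / n.eval n.ptA
    simp only [if_pos hd, eval]
    rw [div_div_div_eq, div_div_div_eq, div_le_div_iff₀ (by positivity) (by positivity)]
    have key : (n.ptC - n.ptB) * (n.num n.ptA * n.den n.ptB) ≤
        (n.ptB - n.ptA) * (n.num n.ptB * n.den n.ptC) :=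
      mul_le_mul hg (mul_le_mul (mono h2.le).1 (mono h3.le).2 qB.le pB.le)
        (by positivity) (by linarith)
    have e : n.num n.ptB * n.den n.ptA * (n.den n.ptC * n.num n.ptB) -
        n.num n.ptC * n.den n.ptB * (n.den n.ptB * n.num n.ptA) =
        n.det * ((n.ptB - n.ptA) * (n.num n.ptB * n.den n.ptC) -
          (n.ptC - n.ptB) * (n.num n.ptA * n.den n.ptB)) := by
      simp only [num, den, det]; ring
    have := mul_nonneg hd.le (sub_nonneg.2 key)
    linarith
  · have hd' := h.det_neg hd
    rw [tree_lo_digit_of_neg _ hd', tree_hi_digit_of_neg _ hd']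
    change _ ≤ n.eval n.ptA / n.eval n.ptB
    simp only [if_neg hd, eval]
    rw [div_div_div_eq, div_div_div_eq, div_le_div_iff₀ (by positivity) (by positivity)]
    have key : (n.ptC - n.ptB) * (n.den n.ptA * n.num n.ptB) ≤
        (n.ptB - n.ptA) * (n.den n.ptB * n.num n.ptC) :=
      mul_le_mul hg (mul_le_mul (mono h2.le).2 (mono h3.le).1 pB.le qB.le)
        (by positivity) (by linarith)
    have e : n.num n.ptA * n.den n.ptB * (n.den n.ptB * n.num n.ptC) -
        n.num n.ptB * n.den n.ptC * (n.den n.ptA * n.num n.ptB) =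
        -n.det * ((n.ptB - n.ptA) * (n.den n.ptB * n.num n.ptC) -
          (n.ptC - n.ptB) * (n.den n.ptA * n.num n.ptB)) := by
      simp only [num, den, det]; ring
    have := mul_nonneg (neg_pos.2 hd').le (sub_nonneg.2 key)
    linarith

lemma Valid.gap_le_size_rest (h : n.Valid) : tree.gap n ≤ tree.size n.rest := by
  obtain ⟨h1, h2, h3, h4⟩ := h.pts
  have pB := h.num_pos (show 0 < n.ptB by linarith)
  have qB := h.den_pos (show 0 < n.ptB by linarith)
  have pC := h.num_pos (show 0 < n.ptC by linarith)
  have qC := h.den_pos (show 0 < n.ptC by linarith)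
  have pD := h.num_pos (show 0 < n.ptD by linarith)
  have qD := h.den_pos (show 0 < n.ptD by linarith)
  obtain ⟨c, hc, hcP, hcQ, hcg⟩ := h.gap_mul_le
  rw [IntervalTree.gap, IntervalTree.size, h.hi_l, h.lo_r, h.tree_rest.1, h.tree_rest.2]
  by_cases hd : 0 < n.det
  · simp only [if_pos hd, eval]
    rw [div_div_div_eq, div_div_div_eq, div_le_div_iff₀ (by positivity) (by positivity)]
    have key : (n.ptC - n.ptB) * (n.num n.ptC * n.den n.ptD) ≤
        (n.ptD - n.ptC) * (n.num n.ptB * n.den n.ptC) :=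
      mul_le_of_shift h.rowP.1 h.rowQ.1 hcP hcQ hc (by linarith) h3.le h4.le (by linarith) hcg
    have e : n.num n.ptD * n.den n.ptC * (n.den n.ptC * n.num n.ptB) -
        n.num n.ptC * n.den n.ptB * (n.den n.ptD * n.num n.ptC) =
        n.det * ((n.ptD - n.ptC) * (n.num n.ptB * n.den n.ptC) -
          (n.ptC - n.ptB) * (n.num n.ptC * n.den n.ptD)) := by
      simp only [num, den, det]; ring
    have := mul_nonneg hd.le (sub_nonneg.2 key)
    linarith
  · have hd' := h.det_neg hd
    simp only [if_neg hd, eval]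
    rw [div_div_div_eq, div_div_div_eq, div_le_div_iff₀ (by positivity) (by positivity)]
    have key : (n.ptC - n.ptB) * (n.den n.ptC * n.num n.ptD) ≤
        (n.ptD - n.ptC) * (n.den n.ptB * n.num n.ptC) :=
      mul_le_of_shift h.rowQ.1 h.rowP.1 hcQ hcP hc (by linarith) h3.le h4.le (by linarith) hcg
    have e : n.num n.ptC * n.den n.ptD * (n.den n.ptB * n.num n.ptC) -
        n.num n.ptB * n.den n.ptC * (n.den n.ptC * n.num n.ptD) =
        -n.det * ((n.ptD - n.ptC) * (n.den n.ptB * n.num n.ptC) -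
          (n.ptC - n.ptB) * (n.den n.ptC * n.num n.ptD)) := by
      simp only [num, den, det]; ring
    have := mul_nonneg (neg_pos.2 hd').le (sub_nonneg.2 key)
    linarith

theorem isThick_tree : tree.IsThick Valid where
  valid_l n h := by
    by_cases hd : 0 < n.det
    · simpa [tree, hd] using h.digit h.one_le
    · simpa [tree, hd] using h.rest
  valid_r n h := by
    by_cases hd : 0 < n.det
    · simpa [tree, hd] using h.rest
    · simpa [tree, hd] using h.digit h.one_le
  lo_pos n h := by
    obtain ⟨h1, h2, h3, h4⟩ := h.pts
    by_cases hd : 0 < n.det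
    · simpa [tree, hd] using h.eval_pos (by linarith)
    · simpa [tree, hd] using h.eval_pos (by linarith)
  lo_le_hi n h := by
    obtain ⟨h1, h2, h3, h4⟩ := h.pts
    by_cases hd : 0 < n.det
    · simpa [tree, hd] using h.eval_le_eval hd.le (by linarith) (by linarith)
    · simpa [tree, hd] using h.eval_le_eval_of_neg (h.det_neg hd).le (by linarith) (by linarith)
  lo_l n h := h.lo_l
  hi_r n h := h.hi_r
  hi_l_le n h := by
    obtain ⟨h1, h2, h3, h4⟩ := h.pts
    rw [h.hi_l]
    by_cases hd : 0 < n.det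
    · simpa [tree, hd] using h.eval_le_eval hd.le (by linarith) (by linarith)
    · simpa [tree, hd] using h.eval_le_eval_of_neg (h.det_neg hd).le (by linarith) (by linarith)
  lo_le_r n h := by
    obtain ⟨h1, h2, h3, h4⟩ := h.pts
    rw [h.lo_r]
    by_cases hd : 0 < n.det
    · simpa [tree, hd] using h.eval_le_eval hd.le (by linarith) (by linarith)
    · simpa [tree, hd] using h.eval_le_eval_of_neg (h.det_neg hd).le (by linarith) (by linarith)
  gap_le_size_l n h := by
    by_cases hd : 0 < n.det
    · simpa only [tree, hd, if_true] using h.gap_le_size_digit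
    · simpa only [tree, hd, if_false] using h.gap_le_size_rest
  gap_le_size_r n h := by
    by_cases hd : 0 < n.det
    · simpa only [tree, hd, if_true] using h.gap_le_size_rest
    · simpa only [tree, hd, if_false] using h.gap_le_size_digit
  gap_l_le n h := by
    by_cases hd : 0 < n.det
    · simpa only [tree, hd, if_true] using h.gap_digit_le le_rfl
    · simpa only [tree, hd, if_false] using h.gap_rest_le
  gap_r_le n h := by
    by_cases hd : 0 < n.det
    · simpa only [tree, hd, if_true] using h.gap_rest_le
    · simpa only [tree, hd, if_false] using h.gap_digit_le le_rfl

end CFNode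

/-! ### From points of the Cantor set to digit sequences -/

namespace CFNode

variable {n : CFNode}

/-- Each binary split detaches only the digit i, so reading one digit takes several splits; d bounds
how many remain. -/
lemma Valid.exists_digit {x : ℝ} : ∀ (d : ℕ) {n : CFNode}, n.Valid → n.s.maxDigit ≤ n.i + d + 1 →
    x ∈ tree.limitSet n → ∃ j, 1 ≤ j ∧ j ≤ n.s.maxDigit ∧ x ∈ tree.limitSet (n.digit j) := by
  intro d
  induction d with
  | zero =>
    intro n h hd hx
    have hr : n.rest = n.digit (n.i + 1) := by rw [CFNode.rest, if_neg (by omega)]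
    have h2 := h.lt_max
    have h1 := h.one_le
    rcases isThick_tree.limitSet_subset h hx with h3 | h3 <;> simp only [tree] at h3 <;>
      split_ifs at h3
    · exact ⟨n.i, h1, h2.le, h3⟩
    · exact ⟨n.i + 1, by omega, h2, hr ▸ h3⟩
    · exact ⟨n.i + 1, by omega, h2, hr ▸ h3⟩
    · exact ⟨n.i, h1, h2.le, h3⟩
  | succ d ih =>
    intro n h hd hx
    have h2 := h.lt_max
    have h1 := h.one_le
    have hrest : x ∈ tree.limitSet n.rest →
        ∃ j, 1 ≤ j ∧ j ≤ n.s.maxDigit ∧ x ∈ tree.limitSet (n.digit j) := by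
      intro h3
      by_cases hi : n.i + 1 < n.s.maxDigit
      · have hr := h.rest
        rw [CFNode.rest, if_pos hi] at h3 hr
        have hd' : n.s.maxDigit ≤ n.i + 1 + d + 1 := by omega
        have := ih hr hd' h3
        exact this
      · rw [CFNode.rest, if_neg hi] at h3
        exact ⟨n.i + 1, by omega, h2, h3⟩
    rcases isThick_tree.limitSet_subset h hx with h3 | h3 <;> simp only [tree] at h3 <;>
      split_ifs at h3
    · exact ⟨n.i, h1, h2.le, h3⟩
    · exact hrest h3
    · exact hrest h3
    · exact ⟨n.i, h1, h2.le, h3⟩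

lemma Valid.exists_eval_eq (h : n.Valid) {x : ℝ} (hx : x ∈ tree.limitSet n) :
    ∃ t, 1 ≤ t ∧ n.eval t = x := by
  obtain ⟨h1, h2, h3, h4⟩ := h.pts
  have hx0 : x ∈ Set.Icc (tree.lo n) (tree.hi n) := Set.mem_iInter.1 hx 0
  have hAD : n.ptA ≤ n.ptD := by linarith
  have hcont : ContinuousOn n.eval (Set.uIcc n.ptA n.ptD) := by
    rw [Set.uIcc_of_le hAD]
    intro t ht
    have hd : n.den t ≠ 0 := (h.den_pos (by linarith [ht.1])).ne'
    simp only [den] at hd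
    unfold CFNode.eval CFNode.num CFNode.den
    exact ContinuousAt.continuousWithinAt (by fun_prop (disch := exact hd))
  have hmem : x ∈ Set.uIcc (n.eval n.ptA) (n.eval n.ptD) := by
    by_cases hd : 0 < n.det
    · simp only [tree, if_pos hd] at hx0
      exact Set.Icc_subset_uIcc hx0
    · simp only [tree, if_neg hd] at hx0
      exact Set.Icc_subset_uIcc' hx0
  obtain ⟨t, ht, rfl⟩ := intermediate_value_uIcc hcont hmem
  rw [Set.uIcc_of_le hAD] at ht
  exact ⟨t, by linarith [ht.1], rfl⟩

/-- The points of the Cantor set below a node are the values of the Möbius map at continued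
fractions whose digits respect the suffix rule. -/
lemma Valid.exists_chain (h : n.Valid) {x : ℝ} (hx : x ∈ tree.limitSet n) :
    ∃ (σ : ℕ → Suffix) (j : ℕ → ℕ) (t : ℕ → ℝ), σ 0 = n.s ∧ (∀ k, σ (k + 1) = (σ k).next (j k)) ∧
      (∀ k, 1 ≤ j k ∧ j k ≤ (σ k).maxDigit) ∧ (∀ k, 1 ≤ t k) ∧
      (∀ k, t k = j k + (t (k + 1))⁻¹) ∧ n.eval (t 0) = x := by
  let S := {m : CFNode // m.Valid ∧ x ∈ tree.limitSet m}
  have step : ∀ m : S, ∃ j, 1 ≤ j ∧ j ≤ m.1.s.maxDigit ∧ x ∈ tree.limitSet (m.1.digit j) :=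
    fun m => m.2.1.exists_digit m.1.s.maxDigit (by omega) m.2.2
  choose f hf using step
  let ν : ℕ → S := fun k => Nat.rec ⟨n, h, hx⟩
    (fun _ m => ⟨m.1.digit (f m), m.2.1.digit (hf m).1, (hf m).2.2⟩) k
  have hν : ∀ k, (ν (k + 1)).1 = (ν k).1.digit (f (ν k)) := fun k => rfl
  choose t ht1 ht using fun k => (ν k).2.1.exists_eval_eq (ν k).2.2
  refine ⟨fun k => (ν k).1.s, fun k => f (ν k), t, rfl, fun k => rfl,
    fun k => ⟨(hf _).1, (hf _).2.1⟩, ht1, fun k => ?_, ht 0⟩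
  have hpos : 0 < t (k + 1) := zero_lt_one.trans_le (ht1 _)
  -- Both t_k and j_k + 1/t_{k+1} are sent to x by the Möbius map of node k, which is injective on
  -- positive numbers.
  refine (ν k).2.1.eval_injOn (zero_lt_one.trans_le (ht1 _)) (by positivity) ?_
  have := ht (k + 1)
  rw [hν, eval_digit _ hpos, one_div] at this
  exact (ht k).trans this.symm

/-- The node of all `[a; j_1, j_2, …]` with `j_1, j_2, …` allowed after the letter `4`. -/
def root (a : ℝ) : CFNode := ⟨a, 1, 1, 0, .s4, 1⟩

lemma valid_root {a : ℝ} (ha : 4 ≤ a) : (root a).Valid where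
  rowP := ⟨by simp only [root]; linarith, by simp [root], by simp only [root]; linarith,
    by simp only [root]; intro; linarith, by simp [root]⟩
  rowQ := ⟨by simp [root], by simp [root], by simp [root], by simp [root], by simp [root]⟩
  det_ne := by simp [root, det]
  one_le := by simp [root]
  lt_max := by simp [root, Suffix.maxDigit]

lemma eval_root {a t : ℝ} (ht : 0 < t) : (root a).eval t = a + t⁻¹ := by
  simp only [eval, num, den, root]; field_simp; ring

lemma tree_lo_root (a : ℝ) : tree.lo (root a) = a + Suffix.low .s4 := by
  have hd : ¬ 0 < (root a).det := by simp only [root, det]; norm_num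
  have h0 := Suffix.low_bounds .s4
  have h1 : (root a).ptD = 1 / Suffix.low .s4 := by rw [Suffix.low_eq]; simp [root, ptD]
  simp only [tree, if_neg hd]
  rw [h1, eval_root (one_div_pos.2 (by linarith)), one_div, inv_inv]

lemma tree_hi_root (a : ℝ) : tree.hi (root a) = a + Suffix.high .s4 := by
  have hd : ¬ 0 < (root a).det := by simp only [root, det]; norm_num
  have h0 := Suffix.high_bounds .s4
  have h1 : (root a).ptA = 1 / Suffix.high .s4 := by rw [Suffix.high_eq]; simp [root, ptA]
  simp only [tree, if_neg hd]
  rw [h1, eval_root (one_div_pos.2 (by linarith)), one_div, inv_inv]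

/-- The initial condition of the gap lemma, used with a and b in both orders. The gap exceeds 1 by
at most 0.472 / ((a C + 1) B) and the size by at least 0.528 / (b + low); b ≤ a + 1 makes the first
denominator the larger one. -/
lemma gap_root_le {a b : ℝ} (ha : 4 ≤ a) (hb : 4 ≤ b) (hab : b ≤ a + 1) :
    tree.gap (root a) ≤ tree.size (root b) := by
  rw [(valid_root ha).gap_eq, IntervalTree.size, tree_lo_root, tree_hi_root]
  have hd : (root a).det = -1 := by simp [root, det]
  obtain ⟨-, ⟨h3, h4⟩, ⟨h5, h6⟩, -⟩ := (root a).pt_bounds le_rfl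
  simp only [root, Nat.cast_one] at h3 h4 h5 h6
  have h0 := Suffix.low_bounds .s4
  have h1 := Suffix.high_bounds .s4
  have hb0 : 0 < b + Suffix.low .s4 := by linarith
  have hden : 0.528 / (b + Suffix.low .s4) + 1 ≤
      (b + Suffix.high .s4) / (b + Suffix.low .s4) := by
    rw [div_add_one hb0.ne']
    exact (div_le_div_iff_of_pos_right hb0).2 (by linarith)
  refine le_trans ?_ hden
  rw [hd, gapDen, if_neg (by rw [hd]; norm_num), abs_neg, abs_one, one_mul, add_comm]
  gcongr ?_ + 1
  change 1 + 0.79 ≤ (root a).ptB at h3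
  change (root a).ptC ≤ _ at h6
  change _ ≤ (root a).ptC at h5
  simp only [num, den, root, one_mul, add_zero]
  change ((root a).ptC - (root a).ptB) / ((a * (root a).ptC + 1) * (root a).ptB) ≤ _
  apply div_le_div₀ (by norm_num) (by linarith) hb0
  have h7 : (2.207 * a + 1) * 1.79 ≤ (a * (root a).ptC + 1) * (root a).ptB := by
    apply mul_le_mul <;> nlinarith
  linarith

end CFNode

/-! ### Large numbers as products of two admissible fractions -/

/-- Continued fraction digits without the factors `44` and `41414`, except that the first digit is
only supposed to be at least `4`. -/
structure Admissible (x : ℕ → ℤ) : Prop where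
  four_le : 4 ≤ x 0
  one_le : ∀ k, 1 ≤ x (k + 1)
  le_four : ∀ k, x (k + 1) ≤ 4
  one_le_three : x 1 ≤ 3
  not_44 : ∀ k, x k = 4 → x (k + 1) ≠ 4
  not_41414 : ∀ k, x k = 4 → x (k + 1) = 1 → x (k + 2) = 4 → x (k + 3) = 1 → x (k + 4) ≠ 4

lemma Admissible.pos {x : ℕ → ℤ} (h : Admissible x) : ∀ k, 1 ≤ x k
  | 0 => by have := h.four_le; omega
  | k + 1 => h.one_le k

lemma exists_admissible_of_mem_limitSet {a : ℕ} (ha : 4 ≤ a) {v : ℝ}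
    (hv : v ∈ CFNode.tree.limitSet (CFNode.root a)) :
    ∃ x : ℕ → ℤ, x 0 = a ∧ Admissible x ∧ infCF x = v := by
  have ha' : (4 : ℝ) ≤ a := by exact_mod_cast ha
  obtain ⟨σ, j, t, hσ0, hσ, hj, ht1, ht, hv⟩ := (CFNode.valid_root ha').exists_chain hv
  rw [CFNode.eval_root (zero_lt_one.trans_le (ht1 0))] at hv
  replace hσ0 : σ 0 = .s4 := hσ0
  let x : ℕ → ℤ := fun k => Nat.casesOn k (a : ℤ) fun k => (j k : ℤ)
  let T : ℕ → ℝ := fun k => Nat.casesOn k v t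
  -- Since x_{k+1} = j_k, the state σ_k is the one reached after x_k; for k = 0 it is `s4` whatever
  -- the value of a.
  have h4 : ∀ k, x k = 4 → σ k = .s4 ∨ σ k = .s414 := by
    rintro (_ | k) hk
    · exact Or.inl hσ0
    · have hk' : j k = 4 := by exact_mod_cast (show (j k : ℤ) = 4 from hk)
      have := hj k
      rw [hσ, hk']
      cases hs : σ k <;> rw [hs, hk'] at this <;> simp [Suffix.next, Suffix.maxDigit] at this ⊢
  have hx : Admissible x := by
    refine ⟨by simpa [x] using ha, fun k => by simpa [x] using (hj k).1, fun k => ?_, ?_, ?_, ?_⟩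
    · have := (hj k).2.trans (Suffix.maxDigit_le _)
      simp only [x]; omega
    · have := (hj 0).2
      rw [hσ0] at this
      exact Int.ofNat_le.2 this
    · intro k hk h
      have h' : j k = 4 := by exact_mod_cast (show (j k : ℤ) = 4 from h)
      have := (hj k).2
      rcases h4 k hk with hs | hs <;> rw [hs, h'] at this <;> simp [Suffix.maxDigit] at this
    · intro k hk h1 h2 h3 h5
      have h1' : j k = 1 := by exact_mod_cast (show (j k : ℤ) = 1 from h1)
      have h2' : j (k + 1) = 4 := by exact_mod_cast (show (j (k + 1) : ℤ) = 4 from h2)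
      have h3' : j (k + 2) = 1 := by exact_mod_cast (show (j (k + 2) : ℤ) = 1 from h3)
      have h5' : j (k + 3) = 4 := by exact_mod_cast (show (j (k + 3) : ℤ) = 4 from h5)
      have e1 := hσ k
      have e2 := hσ (k + 1)
      have e3 := hσ (k + 2)
      have m2 := (hj (k + 1)).2
      have m5 := (hj (k + 3)).2
      rw [h1'] at e1
      rw [h2'] at e2
      rw [h3'] at e3
      rw [h2'] at m2
      rw [h5'] at m5
      rcases h4 k hk with hs | hs <;> rw [hs] at e1 <;> simp only [Suffix.next, if_true] at e1
      · rw [e1] at e2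
        simp only [Suffix.next, if_true] at e2
        rw [e2] at e3
        simp only [Suffix.next, if_true] at e3
        rw [e3] at m5
        simp [Suffix.maxDigit] at m5
      · rw [e1] at m2
        simp [Suffix.maxDigit] at m2
  refine ⟨x, rfl, hx, infCF_eq_of_chain (T := T) hx.pos ?_ ?_⟩
  · rintro (_ | k)
    · have := inv_nonneg.2 (zero_le_one.trans (ht1 0))
      change 1 ≤ v
      linarith
    · exact ht1 k
  · rintro (_ | k)
    · simp only [x, T, ← hv]; norm_cast
    · simpa [x, T] using ht k

/-- With e and m the extreme tails after a 4, consecutive intervals for (a, a), (a, a + 1), (a + 1,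
a + 1) overlap because 2m > 1 + 2e and a ≥ 4. The bound 18.3 exceeds the left end (4 + e)² of the
first interval. -/
lemma exists_center {z : ℝ} (hz : 18.3 ≤ z) : ∃ a b : ℕ, 4 ≤ a ∧ a ≤ b ∧ b ≤ a + 1 ∧
    (a + Suffix.low .s4) * (b + Suffix.low .s4) ≤ z ∧
    z ≤ (a + Suffix.high .s4) * (b + Suffix.high .s4) := by
  have h0 := Suffix.inv_kappa_bounds
  have h1 := Suffix.high_s4_bounds
  rw [show Suffix.low .s4 = 1 / kappa from rfl]
  set e := 1 / kappa
  set m := Suffix.high .s4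
  set a := ⌊√z - e⌋₊
  have hsq := Real.sq_sqrt (show (0 : ℝ) ≤ z by linarith)
  have hs : 4.2613 < √z := Real.lt_sqrt_of_sq_lt (by linarith)
  have h4 : 4 ≤ a := Nat.le_floor (by push_cast; linarith)
  have h4' : (4 : ℝ) ≤ a := by exact_mod_cast h4
  have l1 : (a : ℝ) ≤ √z - e := Nat.floor_le (by linarith)
  have l2 : √z - e < a + 1 := Nat.lt_floor_add_one _
  have l3 : (a + e) * (a + e) ≤ z := by nlinarith
  have l4 : z ≤ (a + 1 + e) * (a + 1 + e) := by nlinarith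
  by_cases hc : z ≤ (a + m) * (a + m)
  · exact ⟨a, a, h4, le_rfl, by omega, l3, hc⟩
  · refine ⟨a, a + 1, h4, by omega, le_rfl, ?_, ?_⟩
    · push_cast; nlinarith
    · push_cast; nlinarith

/-- Every large number is the product of two admissible continued fractions. -/
theorem exists_admissible_mul_eq {z : ℝ} (hz : 18.3 ≤ z) : ∃ x y : ℕ → ℤ,
    Admissible x ∧ Admissible y ∧ infCF x * infCF y = z ∧ (x 0 = 4 ∧ y 0 = 4 ∨ 20 ≤ z) := by
  obtain ⟨a, b, ha, hab, hba, h1, h2⟩ := exists_center hz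
  have ha' : (4 : ℝ) ≤ a := by exact_mod_cast ha
  have hab' : (a : ℝ) ≤ b := by exact_mod_cast hab
  have hba' : (b : ℝ) ≤ a + 1 := by exact_mod_cast hba
  have hb' : (4 : ℝ) ≤ b := ha'.trans hab'
  obtain ⟨u, hu, v, hv, huv⟩ := CFNode.isThick_tree.exists_mul_eq (z := z)
    (CFNode.valid_root ha')
    (CFNode.valid_root hb') (CFNode.gap_root_le ha' hb' hba')
    (CFNode.gap_root_le hb' ha' (by linarith))
    (by rwa [CFNode.tree_lo_root, CFNode.tree_lo_root])
    (by rwa [CFNode.tree_hi_root, CFNode.tree_hi_root])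
  obtain ⟨x, hx0, hx, hxu⟩ := exists_admissible_of_mem_limitSet ha hu
  obtain ⟨y, hy0, hy, hyv⟩ := exists_admissible_of_mem_limitSet (ha.trans hab) hv
  refine ⟨x, y, hx, hy, by rw [hxu, hyv, huv], ?_⟩
  by_cases hb : b = 4
  · left; omega
  · right
    have hb5 : (5 : ℝ) ≤ b := by exact_mod_cast (by omega : 5 ≤ b)
    have := Suffix.low_bounds .s4
    nlinarith

/-! ### Upper bounds for the product at cuts away from 44 -/

lemma inv_le_of_le {t a : ℝ} (ha : 0 < a) (h : a ≤ t) : t⁻¹ ≤ a⁻¹ := inv_anti₀ ha h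

/-- A part of a chain of complete quotients whose digits are at most `4` and avoid `41414`. -/
structure Chain (N : ℕ) (d : ℕ → ℤ) (t : ℕ → ℝ) : Prop where
  eq : ∀ k < N, t k = d k + (t (k + 1))⁻¹
  one_le : ∀ k ≤ N, 1 ≤ d k
  le_four : ∀ k ≤ N, d k ≤ 4
  le_t : ∀ k ≤ N, (d k : ℝ) ≤ t k
  t_le : ∀ k ≤ N, t k ≤ d k + 1
  not_41414 : ∀ k, k + 4 ≤ N → d k = 4 → d (k + 1) = 1 → d (k + 2) = 4 → d (k + 3) = 1 →
    d (k + 4) ≠ 4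

namespace Chain

variable {N : ℕ} {d : ℕ → ℤ} {t : ℕ → ℝ}

lemma shift {j : ℕ} (h : Chain (N + j) d t) : Chain N (fun k => d (k + j)) (fun k => t (k + j)) where
  eq k hk := by rw [h.eq _ (by omega), add_right_comm]
  one_le k hk := h.one_le _ (by omega)
  le_four k hk := h.le_four _ (by omega)
  le_t k hk := h.le_t _ (by omega)
  t_le k hk := h.t_le _ (by omega)
  not_41414 k hk h0 h1 h2 h3 h4 := h.not_41414 (k + j) (by omega) h0
    (by rw [add_right_comm]; exact h1) (by rw [add_right_comm]; exact h2)
    (by rw [add_right_comm]; exact h3) (by rw [add_right_comm]; exact h4)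

lemma one_le_t (h : Chain N d t) {k : ℕ} (hk : k ≤ N) : 1 ≤ t k := by
  have : (1 : ℝ) ≤ d k := by exact_mod_cast h.one_le k hk
  exact this.trans (h.le_t k hk)

lemma t_le_of (h : Chain N d t) {k : ℕ} (hk : k ≤ N) {c : ℤ} (hd : d k ≤ c) : t k ≤ c + 1 := by
  have : (d k : ℝ) ≤ c := by exact_mod_cast hd
  linarith [h.t_le k hk]

lemma le_t_of (h : Chain N d t) {k : ℕ} (hk : k ≤ N) {c : ℤ} (hd : c ≤ d k) : c ≤ t k := by
  have : (c : ℝ) ≤ d k := by exact_mod_cast hd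
  linarith [h.le_t k hk]

lemma succ_eq (h : Chain N d t) {k : ℕ} (hk : k < N) {c : ℤ} (hd : d k = c) :
    t k = c + (t (k + 1))⁻¹ := by rw [h.eq k hk, hd]

/-- A chain which does not begin with `4, 1, 4, 1` is bounded away from the upper extreme. -/
lemma le_of_not_41 (h : Chain N d t) (hN : 4 ≤ N) :
    (t 0 ≤ 4.8182) ∨ (d 0 = 4 ∧ d 1 = 1 ∧ d 2 = 4 ∧ d 3 = 1) := by
  by_cases h0 : d 0 = 4
  swap
  · left
    have := h.t_le_of (k := 0) (by omega) (c := 3)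
      (by have := h.le_four 0 (by omega); omega)
    push_cast at this; linarith
  have e0 := h.succ_eq (by omega) h0
  by_cases h1 : d 1 = 1
  swap
  · left
    have := h.le_t_of (k := 1) (by omega) (c := 2) (by have := h.one_le 1 (by omega); omega)
    push_cast at this e0
    have := inv_le_of_le (by norm_num) this
    norm_num at this e0; linarith
  have e1 := h.succ_eq (by omega) h1
  have b2 : ∀ {b : ℝ}, t 2 ≤ b → t 0 ≤ 4 + (1 + b⁻¹)⁻¹ := by
    intro b hb
    have hp := h.one_le_t (k := 2) (by omega)
    have h1 := inv_le_of_le (by linarith) hb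
    rw [e0, e1]
    push_cast
    have : 0 < b⁻¹ := inv_pos.2 (by linarith)
    gcongr
  by_cases h2 : d 2 = 4
  swap
  · left
    have := h.t_le_of (k := 2) (by omega) (c := 3) (by have := h.le_four 2 (by omega); omega)
    push_cast at this
    have := b2 this
    norm_num at this; linarith
  have e2 := h.succ_eq (by omega) h2
  by_cases h3 : d 3 = 1
  · exact Or.inr ⟨h0, h1, h2, h3⟩
  -- This case is the extreme one: t_2 ≤ 9/2 gives t_0 ≤ 4 + 9/11 = 53/11 < 4.8182.
  · left
    have := h.le_t_of (k := 3) (by omega) (c := 2) (by have := h.one_le 3 (by omega); omega)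
    push_cast at this e2
    have := inv_le_of_le (by norm_num) this
    have : t 2 ≤ 4 + 2⁻¹ := by rw [e2]; linarith
    have := b2 this
    norm_num at this; linarith

/-- A chain close to the upper extreme must begin with 3, 1, 4, 1, 4, 1; the absence of 41414 then
gives d_6 ≤ 3, and the bound can be applied again from there. The map u ↦ (134 u + 111) / (35 u +
29) fixes κ and at least halves the error. The factor 44 need not be excluded, since the extremal
word has 1 after each 4. -/
lemma le_kappa_add : ∀ (m : ℕ) {d : ℕ → ℤ} {t : ℕ → ℝ}, Chain (6 * m) d t → d 0 ≤ 3 →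
    t 0 ≤ kappa + 2 * (1 / 2) ^ m
  | 0, d, t, h, hd => by
    have := h.t_le_of (le_refl _) hd
    have := lt_kappa
    simp only [pow_zero]; push_cast at *; linarith
  | m + 1, d, t, h, hd => by
    have hk := lt_kappa
    have hk' := kappa_lt
    have hδ : 0 < (1 / 2 : ℝ) ^ m := by positivity
    have hpow : (1 / 2 : ℝ) ^ (m + 1) = (1 / 2) ^ m / 2 := by rw [pow_succ]; ring
    rw [hpow]
    by_cases h0 : d 0 = 3
    swap
    · have := h.t_le_of (k := 0) (by omega) (c := 2) (by omega)
      push_cast at this; linarith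
    have e0 := h.succ_eq (by omega) h0
    by_cases h1 : d 1 = 1
    swap
    · have := h.le_t_of (k := 1) (by omega) (c := 2) (by have := h.one_le 1 (by omega); omega)
      push_cast at this e0
      have := inv_le_of_le (by norm_num) this
      norm_num at this e0; linarith
    have e1 := h.succ_eq (by omega) h1
    have b2 : ∀ {b : ℝ}, t 2 ≤ b → t 0 ≤ 3 + (1 + b⁻¹)⁻¹ := by
      intro b hb
      have hp := h.one_le_t (k := 2) (by omega)
      have h1 := inv_le_of_le (by linarith) hb
      rw [e0, e1]
      push_cast
      have : 0 < b⁻¹ := inv_pos.2 (by linarith)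
      gcongr
    have hs := (show Chain (6 * m + 4 + 2) d t from h).shift
    rcases hs.le_of_not_41 (by omega) with h2 | ⟨h2, h3, h4, h5⟩
    -- Here 3 + 1 / (1 + 1/4.8182) < 3.8283 < κ.
    · have := b2 h2
      norm_num at this; linarith
    have h6 : d 6 ≤ 3 := by
      have := h.le_four 6 (by omega)
      have := h.not_41414 2 (by omega) h2 h3 h4 h5
      simp only [Nat.reduceAdd] at this
      omega
    have ih := le_kappa_add m (show Chain (6 * m + 6) d t from h).shift h6
    simp only [zero_add] at h2 h3 h4 h5 ih
    have e2 := h.succ_eq (k := 2) (by omega) h2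
    have e3 := h.succ_eq (k := 3) (by omega) (by simpa [add_comm] using h3)
    have e4 := h.succ_eq (k := 4) (by omega) (by simpa [add_comm] using h4)
    have e5 := h.succ_eq (k := 5) (by omega) (by simpa [add_comm] using h5)
    have p6 := h.one_le_t (k := 6) (by omega)
    simp only [Nat.reduceAdd, zero_add, Int.cast_ofNat, Int.cast_one] at e0 e1 e2 e3 e4 e5
    set u := t 6
    have g5 : t 5 = (u + 1) / u := by rw [e5]; field_simp
    have g4 : t 4 = (5 * u + 4) / (u + 1) := by rw [e4, g5, inv_div]; field_simp; ring
    have g3 : t 3 = (6 * u + 5) / (5 * u + 4) := by rw [e3, g4, inv_div]; field_simp; ring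
    have g2 : t 2 = (29 * u + 24) / (6 * u + 5) := by rw [e2, g3, inv_div]; field_simp; ring
    have g1 : t 1 = (35 * u + 29) / (29 * u + 24) := by rw [e1, g2, inv_div]; field_simp; ring
    have g0 : t 0 = (134 * u + 111) / (35 * u + 29) := by rw [e0, g1, inv_div]; field_simp; ring
    have hq := kappa_quadratic
    rw [g0, div_le_iff₀ (by linarith)]
    nlinarith [mul_nonneg hδ.le (by linarith : 0 ≤ u)]

lemma le_high_add (m : ℕ) (h : Chain (6 * m + 4) d t) :
    t 0 ≤ 4 + Suffix.high .s4 + 2 * (1 / 2) ^ m := by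
  have hk := lt_kappa
  have hk' := kappa_lt
  have hδ : 0 < (1 / 2 : ℝ) ^ m := by positivity
  have hb := Suffix.high_s4_bounds
  rcases h.le_of_not_41 (by omega) with h2 | ⟨h2, h3, h4, h5⟩
  · linarith
  have h6 : d 4 ≤ 3 := by
    have := h.le_four 4 (by omega)
    have := h.not_41414 0 (by omega) h2 h3 h4 h5
    simp only [Nat.reduceAdd] at this
    omega
  have ih := le_kappa_add m h.shift (by simpa using h6)
  simp only [zero_add] at ih
  have e2 := h.succ_eq (k := 0) (by omega) h2
  have e3 := h.succ_eq (k := 1) (by omega) h3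
  have e4 := h.succ_eq (k := 2) (by omega) h4
  have e5 := h.succ_eq (k := 3) (by omega) h5
  have p6 := h.one_le_t (k := 4) (by omega)
  simp only [Nat.reduceAdd, zero_add, Int.cast_ofNat, Int.cast_one] at e2 e3 e4 e5
  set u := t 4
  have g5 : t 3 = (u + 1) / u := by rw [e5]; field_simp
  have g4 : t 2 = (5 * u + 4) / (u + 1) := by rw [e4, g5, inv_div]; field_simp; ring
  have g3 : t 1 = (6 * u + 5) / (5 * u + 4) := by rw [e3, g4, inv_div]; field_simp; ring
  have hu : (5 * u + 4) / (6 * u + 5) - Suffix.high .s4 =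
      (u - kappa) / ((6 * u + 5) * (6 * kappa + 5)) := by
    rw [Suffix.high]
    have h7 : 6 * kappa + 5 ≠ 0 := by linarith
    field_simp; ring
  have hd : (u - kappa) / ((6 * u + 5) * (6 * kappa + 5)) ≤ 2 * (1 / 2) ^ m := by
    have h1 : 1 ≤ (6 * u + 5) * (6 * kappa + 5) := by nlinarith
    rw [div_le_iff₀ (by linarith)]
    nlinarith
  rw [e2, g3, inv_div]
  linarith

/-- The product at a cut between two digits which are not both equal to `4`. -/
lemma mul_le {d' : ℕ → ℤ} {t' : ℕ → ℝ} (m : ℕ) (h : Chain (6 * m + 4) d t)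
    (h' : Chain (6 * m + 4) d' t') (h4 : d 0 ≠ 4 ∨ d' 0 ≠ 4) :
    t 0 * t' 0 ≤ (4 + Suffix.high .s4) * kappa + 30 * (1 / 2) ^ m := by
  have key : ∀ {d d' : ℕ → ℤ} {t t' : ℕ → ℝ}, Chain (6 * m + 4) d t → Chain (6 * m + 4) d' t' →
      d' 0 ≠ 4 → t 0 * t' 0 ≤ (4 + Suffix.high .s4) * kappa + 30 * (1 / 2) ^ m := by
    intro d d' t t' h h' h4
    have hk := lt_kappa
    have hk' := kappa_lt
    have hb := Suffix.high_s4_bounds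
    have hδ : 0 < (1 / 2 : ℝ) ^ m := by positivity
    have hδ1 : (1 / 2 : ℝ) ^ m ≤ 1 := pow_le_one₀ (by norm_num) (by norm_num)
    have l1 := h.le_high_add m
    have l2 := le_kappa_add m
      (show Chain (6 * m) d' t' from ⟨fun k hk => h'.eq k (by omega),
        fun k hk => h'.one_le k (by omega), fun k hk => h'.le_four k (by omega),
        fun k hk => h'.le_t k (by omega), fun k hk => h'.t_le k (by omega),
        fun k hk => h'.not_41414 k (by omega)⟩)
      (by have := h'.le_four 0 (by omega); omega)
    have p1 := h.one_le_t (Nat.zero_le _)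
    have p2 := h'.one_le_t (Nat.zero_le _)
    calc t 0 * t' 0 ≤ (4 + Suffix.high .s4 + 2 * (1 / 2) ^ m) * (kappa + 2 * (1 / 2) ^ m) :=
          mul_le_mul l1 l2 (by linarith) (by linarith)
      -- With δ = (1/2)^m ≤ 1 the error is 2δ(4 + high + κ) + 4δ² < 30δ.
      _ ≤ _ := by nlinarith
  rcases h4 with h4 | h4
  · rw [mul_comm]; exact key h' h h4
  · exact key h h' h4

end Chain

/-! ### The glued sequence of blocks and its forbidden factors -/

/-- The block number of a position in a sequence of blocks of lengths `4, 6, 8, …`. -/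
def blockIndex (N : ℕ) : ℕ := Nat.findGreatest (fun n => n * (n + 3) ≤ N) N

/-- The sequence of blocks `x_n, …, x_0, y_0, …, y_n, 1, 1`. -/
def blockSeq (x y : ℕ → ℤ) (N : ℕ) : ℤ :=
  if N ≤ blockIndex N * (blockIndex N + 3) + blockIndex N then
    x (blockIndex N * (blockIndex N + 3) + blockIndex N - N)
  else if N ≤ blockIndex N * (blockIndex N + 3) + 2 * blockIndex N + 1 then
    y (N - (blockIndex N * (blockIndex N + 3) + blockIndex N + 1))
  else 1

/-- The position of `x_0` in the `n`-th block. -/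
def blockCenter (n : ℕ) : ℕ := n * (n + 3) + n

lemma exists_block (N : ℕ) : ∃ n r, N = n * (n + 3) + r ∧ r < 2 * n + 4 := by
  induction N with
  | zero => exact ⟨0, 0, rfl, by omega⟩
  | succ N ih =>
    obtain ⟨n, r, h, hr⟩ := ih
    by_cases h1 : r + 1 < 2 * n + 4
    · exact ⟨n, r + 1, by omega, h1⟩
    · exact ⟨n + 1, 0, by have : r = 2 * n + 3 := by omega
                          rw [h, this]; ring, by omega⟩

lemma blockIndex_eq {n r : ℕ} (hr : r < 2 * n + 4) : blockIndex (n * (n + 3) + r) = n := by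
  rw [blockIndex, Nat.findGreatest_eq_iff]
  refine ⟨by nlinarith, fun _ => by omega, fun m hm _ h => ?_⟩
  have : (n + 1) * (n + 1 + 3) ≤ m * (m + 3) := Nat.mul_le_mul hm (by omega)
  have : (n + 1) * (n + 1 + 3) = n * (n + 3) + (2 * n + 4) := by ring
  omega

section blockSeq

variable {x y : ℕ → ℤ}

lemma blockSeq_left {n k : ℕ} (hk : k ≤ n) : blockSeq x y (blockCenter n - k) = x k := by
  have e : blockCenter n - k = n * (n + 3) + (n - k) := by rw [blockCenter]; omega
  rw [blockSeq, e, blockIndex_eq (by omega), if_pos (by omega)]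
  congr 1; omega

lemma blockSeq_right {n k : ℕ} (hk : k ≤ n) : blockSeq x y (blockCenter n + 1 + k) = y k := by
  have e : blockCenter n + 1 + k = n * (n + 3) + (n + 1 + k) := by rw [blockCenter]; omega
  rw [blockSeq, e, blockIndex_eq (by omega), if_neg (by omega), if_pos (by omega)]
  congr 1; omega

lemma blockSeq_one {n k : ℕ} (hk : k ≤ 1) : blockSeq x y (blockCenter n + n + 2 + k) = 1 := by
  have e : blockCenter n + n + 2 + k = n * (n + 3) + (2 * n + 2 + k) := by rw [blockCenter]; omega
  rw [blockSeq, e, blockIndex_eq (by omega), if_neg (by omega), if_neg (by omega)]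

/-- Every position is to the left of a center, to the right of it, or between two blocks. -/
lemma position_cases (N : ℕ) : ∃ n, n * (n + 3) ≤ N ∧ N < (n + 1) * (n + 4) ∧
    ((∃ k ≤ n, N + k = blockCenter n) ∨ (∃ k ≤ n, N = blockCenter n + 1 + k) ∨
      N = blockCenter n + n + 2 ∨ N = blockCenter n + n + 3) := by
  obtain ⟨n, r, h, hr⟩ := exists_block N
  have e : (n + 1) * (n + 4) = n * (n + 3) + (2 * n + 4) := by ring
  refine ⟨n, by omega, by omega, ?_⟩
  simp only [blockCenter]
  rcases le_or_gt r n with h1 | h1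
  · exact Or.inl ⟨n - r, by omega, by omega⟩
  rcases le_or_gt r (2 * n + 1) with h2 | h2
  · exact Or.inr (Or.inl ⟨r - n - 1, by omega, by omega⟩)
  rcases (by omega : r = 2 * n + 2 ∨ r = 2 * n + 3) with h3 | h3
  · right; right; left; omega
  · right; right; right; omega

lemma one_le_blockSeq (hx : Admissible x) (hy : Admissible y) (N : ℕ) : 1 ≤ blockSeq x y N := by
  obtain ⟨n, -, -, ⟨k, hk, h⟩ | ⟨k, hk, h⟩ | h | h⟩ := position_cases N
  · rw [show N = blockCenter n - k by omega, blockSeq_left hk]; exact hx.pos k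
  · rw [h, blockSeq_right hk]; exact hy.pos k
  · rw [h]; exact (blockSeq_one (k := 0) (by omega)).ge
  · rw [h]; exact (blockSeq_one (k := 1) (by omega)).ge

lemma blockSeq_le_four (hx : Admissible x) (hy : Admissible y) (N : ℕ) :
    blockSeq x y N ≤ 4 ∨ ∃ n, N = blockCenter n ∨ N = blockCenter n + 1 := by
  obtain ⟨n, -, -, ⟨k, hk, h⟩ | ⟨k, hk, h⟩ | h | h⟩ := position_cases N
  · rcases k with _ | k
    · exact Or.inr ⟨n, Or.inl h⟩
    · left; rw [show N = blockCenter n - (k + 1) by omega, blockSeq_left hk]; exact hx.le_four k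
  · rcases k with _ | k
    · exact Or.inr ⟨n, Or.inr h⟩
    · left; rw [h, blockSeq_right hk]; exact hy.le_four k
  · left; rw [h]; exact (blockSeq_one (k := 0) (by omega)).le.trans (by norm_num)
  · left; rw [h]; exact (blockSeq_one (k := 1) (by omega)).le.trans (by norm_num)

lemma blockSeq_not_44 (hx : Admissible x) (hy : Admissible y) {N : ℕ} (h4 : blockSeq x y N = 4)
    (h4' : blockSeq x y (N + 1) = 4) : ∃ n, N = blockCenter n := by
  obtain ⟨n, -, -, ⟨k, hk, h⟩ | ⟨k, hk, h⟩ | h | h⟩ := position_cases N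
  · rcases k with _ | k
    · exact ⟨n, h⟩
    · rw [show N = blockCenter n - (k + 1) by omega, blockSeq_left hk] at h4
      rw [show N + 1 = blockCenter n - k by omega, blockSeq_left (by omega)] at h4'
      exact (hx.not_44 k h4' h4).elim
  · rcases hk.lt_or_eq with hk' | rfl
    · rw [h, blockSeq_right hk] at h4
      rw [h, add_assoc _ k, blockSeq_right hk'] at h4'
      exact (hy.not_44 k h4 h4').elim
    · rw [show N + 1 = blockCenter k + k + 2 + 0 by omega, blockSeq_one (by omega)] at h4'
      norm_num at h4'
  · rw [h, ← add_zero (blockCenter n + n + 2), blockSeq_one (by omega)] at h4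
    norm_num at h4
  · rw [h, show blockCenter n + n + 3 = blockCenter n + n + 2 + 1 by omega,
      blockSeq_one (by omega)] at h4
    norm_num at h4

/-- The word has no two equal neighbours, so it can contain neither the separator 1, 1 nor the
central 44. Inside a half it is excluded by admissibility. -/
lemma blockSeq_not_41414 (hx : Admissible x) (hy : Admissible y) (hx0 : x 0 = 4) (hy0 : y 0 = 4)
    {N : ℕ} (h0 : blockSeq x y N = 4) (h1 : blockSeq x y (N + 1) = 1)
    (h2 : blockSeq x y (N + 2) = 4) (h3 : blockSeq x y (N + 3) = 1) :
    blockSeq x y (N + 4) ≠ 4 := by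
  intro h4
  obtain ⟨n, r, h, hr⟩ := exists_block N
  have hc : blockCenter n = n * (n + 3) + n := rfl
  have one : ∀ M, M = blockCenter n + n + 2 ∨ M = blockCenter n + n + 3 →
      blockSeq x y M = 1 := by
    rintro M (rfl | rfl)
    · exact blockSeq_one (k := 0) (by omega)
    · exact blockSeq_one (k := 1) (by omega)
  -- If the word meets the separator, one of its letters 4 falls on a digit 1.
  rcases le_or_gt (2 * n + 2) (r + 4) with hr4 | hr4
  · rcases (by omega : r = 2 * n + 3 ∨ r = 2 * n + 2 ∨ r = 2 * n + 1 ∨ r = 2 * n ∨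
      r + 1 = 2 * n ∨ r + 2 = 2 * n) with e | e | e | e | e | e
    · have := one N (by omega); omega
    · have := one N (by omega); omega
    · have := one (N + 2) (by omega); omega
    · have := one (N + 2) (by omega); omega
    · have := one (N + 4) (by omega); omega
    · have := one (N + 4) (by omega); omega
  rcases le_or_gt (r + 4) n with hn | hn
  · obtain ⟨k, rfl⟩ : ∃ k, n = r + 4 + k := ⟨n - (r + 4), by omega⟩
    rw [show N = blockCenter (r + 4 + k) - (k + 4) by omega, blockSeq_left (by omega)] at h0
    rw [show N + 1 = blockCenter (r + 4 + k) - (k + 3) by omega, blockSeq_left (by omega)] at h1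
    rw [show N + 2 = blockCenter (r + 4 + k) - (k + 2) by omega, blockSeq_left (by omega)] at h2
    rw [show N + 3 = blockCenter (r + 4 + k) - (k + 1) by omega, blockSeq_left (by omega)] at h3
    rw [show N + 4 = blockCenter (r + 4 + k) - k by omega, blockSeq_left (by omega)] at h4
    exact hx.not_41414 k h4 h3 h2 h1 h0
  rcases le_or_gt r n with hn' | hn'
  · have c0 : blockSeq x y (blockCenter n) = 4 := by
      rw [← Nat.sub_zero (blockCenter n), blockSeq_left (by omega), hx0]
    have c1 : blockSeq x y (blockCenter n + 1) = 4 := by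
      rw [← add_zero (blockCenter n + 1), blockSeq_right (by omega), hy0]
    rcases (by omega : n = r ∨ n = r + 1 ∨ n = r + 2 ∨ n = r + 3) with e | e | e | e
    · rw [show blockCenter n + 1 = N + 1 by omega] at c1; omega
    · rw [show blockCenter n = N + 1 by omega] at c0; omega
    · rw [show blockCenter n + 1 = N + 3 by omega] at c1; omega
    · rw [show blockCenter n = N + 3 by omega] at c0; omega
  · obtain ⟨k, rfl⟩ : ∃ k, r = n + 1 + k := ⟨r - (n + 1), by omega⟩
    rw [show N = blockCenter n + 1 + k by omega, blockSeq_right (by omega)] at h0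
    rw [show N + 1 = blockCenter n + 1 + (k + 1) by omega, blockSeq_right (by omega)] at h1
    rw [show N + 2 = blockCenter n + 1 + (k + 2) by omega, blockSeq_right (by omega)] at h2
    rw [show N + 3 = blockCenter n + 1 + (k + 3) by omega, blockSeq_right (by omega)] at h3
    rw [show N + 4 = blockCenter n + 1 + (k + 4) by omega, blockSeq_right (by omega)] at h4
    exact hy.not_41414 k h0 h1 h2 h3 h4

end blockSeq

/-! ### The upper limit along the glued sequence -/

lemma leftCF_bounds {s : ℕ → ℤ} (hs : ∀ k, 1 ≤ s k) (N : ℕ) :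
    (s N : ℝ) ≤ leftCF s N ∧ leftCF s N ≤ s N + 1 := by
  rcases N with _ | N
  · rw [leftCF_zero]; constructor <;> linarith
  · have h := one_le_leftCF hs N
    have h1 := inv_nonneg.2 (zero_le_one.trans h)
    have h2 := inv_le_one_of_one_le₀ h
    rw [leftCF_succ]; constructor <;> linarith

lemma rightCF_bounds {s : ℕ → ℤ} (hs : ∀ k, 1 ≤ s k) (N : ℕ) :
    (s N : ℝ) ≤ rightCF s N ∧ rightCF s N ≤ s N + 1 := by
  have h := one_le_rightCF (n := N + 1) fun k _ => hs k
  have h1 := inv_nonneg.2 (zero_le_one.trans h)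
  have h2 := inv_le_one_of_one_le₀ h
  rw [rightCF_eq fun k _ => hs k]; constructor <;> linarith

/-- Serves both halves of a block: f n shares its first n digits with x, and its remaining quotient
g n has integer part close enough to x_n for the contraction to give an error of at most 2 (1/2)^n.
-/
lemma tendsto_of_cfTail {x : ℕ → ℤ} (hx : ∀ k, 1 ≤ x k) {f g : ℕ → ℝ}
    (hf : ∀ n, f n = cfTail n x (g n)) (hg : ∀ n, (x n : ℝ) ≤ g n ∧ g n ≤ x n + 1) :
    Tendsto f atTop (𝓝 (infCF x)) := by
  rw [tendsto_iff_dist_tendsto_zero]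
  have h2 : Tendsto (fun n : ℕ => 2 * (1 / 2 : ℝ) ^ n) atTop (𝓝 0) := by
    simpa using (tendsto_pow_atTop_nhds_zero_of_lt_one (by norm_num : (0 : ℝ) ≤ 1 / 2)
      (by norm_num)).const_mul 2
  refine squeeze_zero (fun _ => dist_nonneg) (fun n => ?_) h2
  have e : infCF x = cfTail n x (rightCF x n) := by
    have := eq_cfTail (x := x) (T := rightCF x) n fun k _ => rightCF_eq fun j _ => hx j
    rw [← this]; simp [rightCF]
  have h1 : (1 : ℝ) ≤ x n := by exact_mod_cast hx n
  have hr := rightCF_bounds hx n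
  rw [Real.dist_eq, hf, e]
  refine (dist_cfTail_le n x _ _ (fun k _ => hx k) (h1.trans (hg n).1) (h1.trans hr.1)).trans ?_
  have : |g n - rightCF x n| ≤ 1 := by
    have := hg n
    rw [abs_le]; constructor <;> linarith
  nlinarith [pow_pos (by norm_num : (0 : ℝ) < 1 / 2) n]

section limsup

variable {x y : ℕ → ℤ}

lemma tendsto_center (hx : Admissible x) (hy : Admissible y) :
    Tendsto (fun n => leftCF (blockSeq x y) (blockCenter n) *
      rightCF (blockSeq x y) (blockCenter n + 1)) atTop (𝓝 (infCF x * infCF y)) := by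
  have hs := one_le_blockSeq hx hy
  refine Tendsto.mul ?_ ?_
  · refine tendsto_of_cfTail hx.pos (g := fun n => leftCF (blockSeq x y) (blockCenter n - n))
      (fun n => ?_) fun n => ?_
    · have := eq_cfTail (x := x) (T := fun k => leftCF (blockSeq x y) (blockCenter n - k)) n ?_
      · simpa using this
      · intro k hk
        have hc : blockCenter n = n * (n + 3) + n := rfl
        rw [← blockSeq_left (x := x) (y := y) hk.le,
          show blockCenter n - k = blockCenter n - (k + 1) + 1 by omega, leftCF_succ]
    · rw [← blockSeq_left (x := x) (y := y) (le_refl n)]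
      exact leftCF_bounds hs _
  · refine tendsto_of_cfTail hy.pos (g := fun n => rightCF (blockSeq x y) (blockCenter n + 1 + n))
      (fun n => ?_) fun n => ?_
    · have := eq_cfTail (x := y) (T := fun k => rightCF (blockSeq x y) (blockCenter n + 1 + k)) n ?_
      · simpa using this
      · intro k hk
        rw [← blockSeq_right (x := x) (y := y) hk.le, rightCF_eq fun j _ => hs j]
        rfl
    · rw [← blockSeq_right (x := x) (y := y) (le_refl n)]
      exact rightCF_bounds hs _

/-- Compares the cuts on the two sides of a digit a whose neighbouring quotients are u ≤ v: here u a
≤ a v and u/v ≤ 1 ≤ v/u. -/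
lemma mul_add_inv_le {a u v : ℝ} (ha : 0 ≤ a) (hu : 0 < u) (huv : u ≤ v) :
    u * (a + v⁻¹) ≤ (a + u⁻¹) * v := by
  have h1 : u * v⁻¹ ≤ 1 := by rw [← div_eq_mul_inv, div_le_one (hu.trans_le huv)]; exact huv
  have h2 : 1 ≤ u⁻¹ * v := by rw [inv_mul_eq_div, one_le_div hu]; exact huv
  nlinarith

lemma left_of_center_le (hx : Admissible x) (hy : Admissible y) {n N : ℕ} (hn : 1 ≤ n)
    (hN : N + 1 = blockCenter n) : leftCF (blockSeq x y) N * rightCF (blockSeq x y) (N + 1) ≤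
      leftCF (blockSeq x y) (blockCenter n) * rightCF (blockSeq x y) (blockCenter n + 1) := by
  have hs := one_le_blockSeq hx hy
  rw [← hN, leftCF_succ, rightCF_eq (n := N + 1) fun j _ => hs j]
  have h1 := one_le_leftCF hs N
  refine mul_add_inv_le ?_ (by linarith) ?_
  · exact_mod_cast zero_le_one.trans (hs (N + 1))
  -- The left quotient is at most x_1 + 1 ≤ 4 and the right one at least y_0 ≥ 4.
  · have e1 : blockSeq x y N = x 1 := by
      rw [show N = blockCenter n - 1 by omega, blockSeq_left hn]
    have e2 : blockSeq x y (N + 1 + 1) = y 0 := by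
      rw [hN, ← add_zero (blockCenter n + 1), blockSeq_right (Nat.zero_le _)]
    have h2 := (leftCF_bounds hs N).2
    have h3 := (rightCF_bounds hs (N + 1 + 1)).1
    rw [e1] at h2
    rw [e2] at h3
    have h4 : (x 1 : ℝ) ≤ 3 := by exact_mod_cast hx.one_le_three
    have h5 : (4 : ℝ) ≤ y 0 := by exact_mod_cast hy.four_le
    linarith

lemma right_of_center_le (hx : Admissible x) (hy : Admissible y) {n : ℕ} (hn : 1 ≤ n) :
    leftCF (blockSeq x y) (blockCenter n + 1) * rightCF (blockSeq x y) (blockCenter n + 2) ≤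
      leftCF (blockSeq x y) (blockCenter n) * rightCF (blockSeq x y) (blockCenter n + 1) := by
  have hs := one_le_blockSeq hx hy
  rw [leftCF_succ, rightCF_eq (n := blockCenter n + 1) fun j _ => hs j, mul_comm,
    mul_comm (leftCF _ _)]
  have h1 := one_le_rightCF (n := blockCenter n + 2) fun j _ => hs j
  refine mul_add_inv_le ?_ (by linarith) ?_
  · exact_mod_cast zero_le_one.trans (hs (blockCenter n + 1))
  · have e1 : blockSeq x y (blockCenter n + 2) = y 1 := by
      rw [show blockCenter n + 2 = blockCenter n + 1 + 1 by omega, blockSeq_right hn]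
    have e2 : blockSeq x y (blockCenter n) = x 0 := by
      rw [← Nat.sub_zero (blockCenter n), blockSeq_left (Nat.zero_le _)]
    have h2 := (rightCF_bounds hs (blockCenter n + 2)).2
    have h3 := (leftCF_bounds hs (blockCenter n)).1
    rw [e1] at h2
    rw [e2] at h3
    have h4 : (y 1 : ℝ) ≤ 3 := by exact_mod_cast hy.one_le_three
    have h5 : (4 : ℝ) ≤ x 0 := by exact_mod_cast hx.four_le
    linarith

lemma blockSeq_mul_le (hx : Admissible x) (hy : Admissible y) (hx0 : x 0 = 4) (hy0 : y 0 = 4)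
    {m N : ℕ} (hm : 6 * m + 4 ≤ N) (h4 : blockSeq x y N ≠ 4 ∨ blockSeq x y (N + 1) ≠ 4) :
    leftCF (blockSeq x y) N * rightCF (blockSeq x y) (N + 1) ≤
      (4 + Suffix.high .s4) * kappa + 30 * (1 / 2) ^ m := by
  have hs := one_le_blockSeq hx hy
  have hle : ∀ k, blockSeq x y k ≤ 4 := by
    intro k
    rcases blockSeq_le_four hx hy k with h | ⟨n, rfl | rfl⟩
    · exact h
    · rw [← Nat.sub_zero (blockCenter n), blockSeq_left (Nat.zero_le _), hx0]
    · rw [← add_zero (blockCenter n + 1), blockSeq_right (Nat.zero_le _), hy0]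
  have hl : Chain (6 * m + 4) (fun k => blockSeq x y (N - k))
      (fun k => leftCF (blockSeq x y) (N - k)) :=
    { eq := fun k hk => by
        rw [show N - k = N - (k + 1) + 1 by omega, leftCF_succ]
      one_le := fun k _ => hs _
      le_four := fun k _ => hle _
      le_t := fun k _ => (leftCF_bounds hs _).1
      t_le := fun k _ => (leftCF_bounds hs _).2
      not_41414 := fun k hk h0 h1 h2 h3 h4 => by
        rw [show N - k = N - (k + 4) + 4 by omega] at h0
        rw [show N - (k + 1) = N - (k + 4) + 3 by omega] at h1
        rw [show N - (k + 2) = N - (k + 4) + 2 by omega] at h2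
        rw [show N - (k + 3) = N - (k + 4) + 1 by omega] at h3
        exact blockSeq_not_41414 hx hy hx0 hy0 h4 h3 h2 h1 h0 }
  have hr : Chain (6 * m + 4) (fun k => blockSeq x y (N + 1 + k))
      (fun k => rightCF (blockSeq x y) (N + 1 + k)) :=
    { eq := fun k hk => rightCF_eq fun j _ => hs j
      one_le := fun k _ => hs _
      le_four := fun k _ => hle _
      le_t := fun k _ => (rightCF_bounds hs _).1
      t_le := fun k _ => (rightCF_bounds hs _).2
      not_41414 := fun k hk => blockSeq_not_41414 hx hy hx0 hy0 }
  simpa using Chain.mul_le m hl hr (by simpa using h4)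

lemma limsup_blockSeq (hx : Admissible x) (hy : Admissible y) {z : ℝ} (hz : infCF x * infCF y = z)
    (hz0 : (4 + Suffix.high .s4) * kappa ≤ z) (h20 : x 0 = 4 ∧ y 0 = 4 ∨ 20 ≤ z) :
    limsup (fun N => ((leftCF (blockSeq x y) N * rightCF (blockSeq x y) (N + 1) : ℝ) : EReal))
      atTop = z := by
  have hs := one_le_blockSeq hx hy
  have hc := tendsto_center hx hy
  rw [hz] at hc
  refine limsup_coe_eq (c := blockCenter) ?_ hc ?_
  · exact tendsto_atTop_mono (fun n => by simp [blockCenter]) tendsto_id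
  intro ε hε
  obtain ⟨n₀, hn₀⟩ := eventually_atTop.1 (hc.eventually (gt_mem_nhds (by linarith : z < z + ε)))
  have hpow : Tendsto (fun n : ℕ => 30 * (1 / 2 : ℝ) ^ n) atTop (𝓝 0) := by
    simpa using (tendsto_pow_atTop_nhds_zero_of_lt_one (by norm_num : (0 : ℝ) ≤ 1 / 2)
      (by norm_num)).const_mul 30
  obtain ⟨m, hm⟩ := (hpow.eventually (gt_mem_nhds hε)).exists
  filter_upwards [eventually_ge_atTop ((n₀ + 1) * (n₀ + 4)), eventually_ge_atTop (6 * m + 4)]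
    with N hN hNm
  have key : ∀ n, N < (n + 1) * (n + 4) → n₀ + 1 ≤ n := by
    intro n hn
    by_contra hlt
    have : (n + 1) * (n + 4) ≤ (n₀ + 1) * (n₀ + 4) := Nat.mul_le_mul (by omega) (by omega)
    omega
  obtain ⟨n, h1, h2, -⟩ := position_cases N
  have hn := key n h2
  by_cases c0 : N = blockCenter n
  · rw [c0]; exact (hn₀ n (by omega)).le
  by_cases c1 : N + 1 = blockCenter n
  · exact (left_of_center_le hx hy (by omega) c1).trans (hn₀ n (by omega)).le
  by_cases c2 : N = blockCenter n + 1
  · rw [c2]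
    exact (right_of_center_le hx hy (by omega)).trans (hn₀ n (by omega)).le
  -- Centres of other blocks are too far away: the cut N and a cut next to the centre of block n'
  -- lie in the same block.
  have hbc : ∀ n', (N = blockCenter n' ∨ N = blockCenter n' + 1 ∨ N + 1 = blockCenter n') →
      n' = n := by
    intro n' hn'
    have hlt : ∀ a b, a < b → (a + 1) * (a + 4) ≤ b * (b + 3) := fun a b hab =>
      Nat.mul_le_mul hab (by omega)
    have e : (n' + 1) * (n' + 4) = n' * (n' + 3) + (2 * n' + 4) := by ring
    have hcn : blockCenter n' = n' * (n' + 3) + n' := rfl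
    rcases lt_trichotomy n' n with h | h | h
    · have := hlt _ _ h
      omega
    · exact h
    · have := hlt _ _ h
      omega
  have hcase : blockSeq x y N ≤ 4 ∧ blockSeq x y (N + 1) ≤ 4 ∧
      (blockSeq x y N ≠ 4 ∨ blockSeq x y (N + 1) ≠ 4) := by
    refine ⟨?_, ?_, ?_⟩
    · rcases blockSeq_le_four hx hy N with h | ⟨n', h⟩
      · exact h
      · have := hbc n' (by tauto)
        subst this; tauto
    · rcases blockSeq_le_four hx hy (N + 1) with h | ⟨n', h⟩
      · exact h
      · have := hbc n' (by omega)
        subst this; omega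
    · by_contra! h
      obtain ⟨n', h'⟩ := blockSeq_not_44 hx hy h.1 h.2
      have := hbc n' (by tauto)
      subst this; tauto
  obtain ⟨a1, a2, a3⟩ := hcase
  rcases h20 with ⟨hx0, hy0⟩ | h20
  · have := blockSeq_mul_le hx hy hx0 hy0 hNm a3
    linarith
  -- Digits at most 4 and not both 4 bound the product by (4 + 1)(3 + 1) = 20.
  · have b1 := (leftCF_bounds hs N).2
    have b2 := (rightCF_bounds hs (N + 1)).2
    have b3 := one_le_leftCF hs N
    have b4 := one_le_rightCF (n := N + 1) fun j _ => hs j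
    have k1 : (blockSeq x y N : ℝ) ≤ 4 := by exact_mod_cast a1
    have k2 : (blockSeq x y (N + 1) : ℝ) ≤ 4 := by exact_mod_cast a2
    rcases a3 with h | h
    · have k3 : (blockSeq x y N : ℝ) ≤ 3 := by exact_mod_cast (by omega : blockSeq x y N ≤ 3)
      nlinarith
    · have k3 : (blockSeq x y (N + 1) : ℝ) ≤ 3 := by
        exact_mod_cast (by omega : blockSeq x y (N + 1) ≤ 3)
      nlinarith

end limsup

/-! ### The ray in the spectrum and the values of the periodic fractions -/

lemma mem_rhoSpectrum {z : ℝ} (hz : (4 + Suffix.high .s4) * kappa ≤ z) : z ∈ rhoSpectrum := by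
  have h1 := Suffix.high_s4_bounds
  have h2 := lt_kappa
  obtain ⟨x, y, hx, hy, hxy, h20⟩ := exists_admissible_mul_eq (z := z) (by nlinarith)
  obtain ⟨α, hα, hq⟩ := exists_irrational_partialQuotient_eq (one_le_blockSeq hx hy)
  refine ⟨α, hα, ?_⟩
  rw [rho]
  simp only [rhoTerm_eq, hq]
  exact limsup_blockSeq hx hy hxy hz h20

lemma mem_rayOrigins : (4 + Suffix.high .s4) * kappa ∈ rayOrigins :=
  fun _ hz => mem_rhoSpectrum hz

lemma bddBelow_rayOrigins : BddBelow rayOrigins :=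
  ⟨0, fun _ hz => nonneg_of_mem_rhoSpectrum (hz (Set.mem_Ici.2 le_rfl))⟩

lemma periodicCF_314141 : periodicCF [3, 1, 4, 1, 4, 1] = kappa := by
  set x : ℕ → ℤ := fun n => [3, 1, 4, 1, 4, 1].getD (n % 6) 0
  have hx : ∀ k, 1 ≤ x k := by
    intro k
    have : k % 6 < 6 := Nat.mod_lt _ (by norm_num)
    simp only [x]
    interval_cases k % 6 <;> simp
  have hp : (fun k => x (6 + k)) = x := by
    funext k; simp [x]
  have h := eq_cfTail (x := x) (T := rightCF x) 6 fun k _ => rightCF_eq fun j _ => hx j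
  have h6 : rightCF x 6 = rightCF x 0 := by rw [rightCF, hp]; simp [rightCF]
  have h1 := one_le_rightCF (n := 0) fun k _ => hx k
  have hV : periodicCF [3, 1, 4, 1, 4, 1] = rightCF x 0 := by
    simp only [rightCF, zero_add]; rfl
  rw [hV]
  rw [h6] at h
  set V := rightCF x 0
  simp [cfTail, x] at h
  have e1 : 1 + V⁻¹ = (V + 1) / V := by field_simp
  have e2 : 4 + ((V + 1) / V)⁻¹ = (5 * V + 4) / (V + 1) := by field_simp; ring
  have e3 : 1 + ((5 * V + 4) / (V + 1))⁻¹ = (6 * V + 5) / (5 * V + 4) := by field_simp; ring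
  have e4 : 4 + ((6 * V + 5) / (5 * V + 4))⁻¹ = (29 * V + 24) / (6 * V + 5) := by
    field_simp; ring
  have e5 : 1 + ((29 * V + 24) / (6 * V + 5))⁻¹ = (35 * V + 29) / (29 * V + 24) := by
    field_simp; ring
  rw [e1, e2, e3, e4, e5, inv_div, ← sub_eq_iff_eq_add', eq_div_iff (by positivity)] at h
  have hq := kappa_quadratic
  have hk := lt_kappa
  have : (V - kappa) * (35 * (V + kappa) - 105) = 0 := by nlinarith
  -- The other root of the quadratic is 3 - κ < 0, whereas V ≥ 1.
  rcases mul_eq_zero.1 this with h0 | h0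
  · linarith
  · linarith

lemma periodicCF_414131 : periodicCF [4, 1, 4, 1, 3, 1] = 4 + Suffix.high .s4 := by
  set x : ℕ → ℤ := fun n => [4, 1, 4, 1, 3, 1].getD (n % 6) 0
  have hx : ∀ k, 1 ≤ x k := by
    intro k
    have : k % 6 < 6 := Nat.mod_lt _ (by norm_num)
    simp only [x]
    interval_cases k % 6 <;> simp
  have hp : (fun k => x (4 + k)) = fun n => [3, 1, 4, 1, 4, 1].getD (n % 6) 0 := by
    funext k
    have : k % 6 < 6 := Nat.mod_lt _ (by norm_num)
    simp only [x, Nat.add_mod 4 k]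
    interval_cases k % 6 <;> rfl
  have h := eq_cfTail (x := x) (T := rightCF x) 4 fun k _ => rightCF_eq fun j _ => hx j
  have h4 : rightCF x 4 = kappa := by
    rw [← periodicCF_314141, rightCF, hp]; rfl
  have hV : periodicCF [4, 1, 4, 1, 3, 1] = rightCF x 0 := by
    simp only [rightCF, zero_add]; rfl
  rw [hV, h, h4, Suffix.high]
  have hk := lt_kappa
  have hk0 : 0 < kappa := by linarith
  simp only [cfTail, x]
  simp
  field_simp
  ring

end

theorem theorem1p3 :
    IsGLB rayOrigins mu ∧
    mu ≤ periodicCF [4, 1, 4, 1, 3, 1] * periodicCF [3, 1, 4, 1, 4, 1] ∧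
    periodicCF [4, 1, 4, 1, 3, 1] * periodicCF [3, 1, 4, 1, 4, 1] =
      111 * (175 + Real.sqrt 26565) / 2030 ∧
    |periodicCF [4, 1, 4, 1, 3, 1] * periodicCF [3, 1, 4, 1, 4, 1] - 18.4811| < 0.00005 := by
  rw [periodicCF_314141, periodicCF_414131]
  have hval : (4 + Suffix.high .s4) * kappa = 111 * (175 + Real.sqrt 26565) / 2030 := by
    have hs := Real.sq_sqrt (show (0 : ℝ) ≤ 26565 by norm_num)
    have h0 := Real.sqrt_nonneg 26565
    rw [Suffix.high, kappa]
    have : 6 * ((105 + √26565) / 70) + 5 ≠ 0 := by positivity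
    field_simp
    nlinarith
  refine ⟨Real.isGLB_sInf ⟨_, mem_rayOrigins⟩ bddBelow_rayOrigins,
    csInf_le bddBelow_rayOrigins mem_rayOrigins, hval, ?_⟩
  rw [hval]
  have h1 : (162.987 : ℝ) < √26565 := Real.lt_sqrt_of_sq_lt (by norm_num)
  have h2 : √26565 < (162.988 : ℝ) := (Real.sqrt_lt' (by norm_num)).2 (by norm_num)
  rw [abs_lt]
  constructor <;> linarith
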